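/- **Theorem 2.10 (Linear singular perturbation).** Let $H$ be a real Hilbert space and let $A$ be a self-adjoint operator on $H$ with dense domain $D(A)$ which is coercive: $\langle Ax,x\rangle\ge\nu|x|^2$ for every $x\in D(A)$, for some constant $\nu>0$. Let $p\in[0,1]$, let $(u_0,u_1)\in D(A)\times D(A^{1/2})$, and let $\varepsilon_0>0$, $\mu>0$ and $M_1,\dots,M_5$ be real constants. Let $c:[0,+\infty)\to(0,+\infty)$ and $c_\varepsilon:[0,+\infty)\to(0,+\infty)$, $\varepsilon\in(0,\varepsilon_0)$, be functions of class $C^1$ such that, for every $t\ge 0$ and every $\varepsilon\in(0,\varepsilon_0)$, $$\mu\le c(t)\le M_1,\qquad |c'(t)|\le M_2,\qquad \mu\le c_\varepsilon(t)\le M_3,\qquad |c_\varepsilon'(t)|\le\frac{M_4}{(1+t)^p},\qquad |c_\varepsilon(t)-c(t)|\le M_5\,\varepsilon .$$ Let $u\in C^1([0,+\infty);H)\cap C^0([0,+\infty);D(A))$ be the solution of $$\frac{1}{(1+t)^p}u'(t)+c(t)Au(t)=0\quad(t\ge0),\qquad u(0)=u_0,$$ and, for $\varepsilon\in(0,\varepsilon_0)$,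 let $u_\varepsilon\in C^2([0,+\infty);H)\cap C^1([0,+\infty);D(A^{1/2}))\cap C^0([0,+\infty);D(A))$ be the solution of $$\varepsilon u_\varepsilon''(t)+\frac{1}{(1+t)^p}u_\varepsilon'(t)+c_\varepsilon(t)Au_\varepsilon(t)=0\quad(t\ge0),\qquad u_\varepsilon(0)=u_0,\quad u_\varepsilon'(0)=u_1 .$$ Let the corrector $\theta_\varepsilon\in C^2([0,+\infty);H)$ be the solution of $$\varepsilon\theta_\varepsilon''(t)+\frac{1}{(1+t)^p}\theta_\varepsilon'(t)=0\quad(t\ge0),\qquad \theta_\varepsilon(0)=0,\quad \theta_\varepsilon'(0)=u_1+c(0)Au_0,$$ and set $\rho_\varepsilon:=u_\varepsilon-u$ and $r_\varepsilon:=u_\varepsilon-u-\theta_\varepsilon$. Define $$\Gamma_{r,\varepsilon}(t):=|\rho_\varepsilon(t)|^2+|A^{1/2}\rho_\varepsilon(t)|^2+\varepsilon|r_\varepsilon'(t)|^2,$$ $$\Gamma_{c,\varepsilon}(t):=|\rho_\varepsilon(t)|^2+|A^{1/2}\rho_\varepsilon(t)|^2+|A\rho_\varepsilon(t)|^2+|r_\varepsilon'(t)|^2+\varepsilon|A^{1/2}r_\varepsilon'(t)|^2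 .$$ (1) If in addition $(u_0,u_1)\in D(A^{3/2})\times D(A^{1/2})$, then the following estimates hold. - Case $p=0$: for every $\beta<2\mu\nu$ there exist $\varepsilon_1\in(0,\varepsilon_0]$ and $C$ such that $\Gamma_{r,\varepsilon}(t)\le C\varepsilon^2e^{-\beta t}$ for every $t\ge0$ and every $\varepsilon\in(0,\varepsilon_1)$. - Case $p\in(0,1)$: for every $\beta>0$ there exist $\varepsilon_1\in(0,\varepsilon_0]$ and $C$ such that $\Gamma_{r,\varepsilon}(t)\le C\varepsilon^2e^{-\beta(1+t)^{1-p}}$ for every $t\ge0$ and every $\varepsilon\in(0,\varepsilon_1)$. - Case $p=1$: for every $\beta>0$ there exist $\varepsilon_1\in(0,\varepsilon_0]$ and $C$ such that $\Gamma_{r,\varepsilon}(t)\le \dfrac{C\varepsilon^2}{(1+t)^{\beta}}$ for every $t\ge0$ and every $\varepsilon\in(0,\varepsilon_1)$. The constants $\varepsilon_1$ and $C$ may depend on $\beta$, but not on $t$ and $\varepsilon$. (2) If in addition $(u_0,u_1)\in D(A^2)\times D(A)$, then $r_\varepsilon'(t)\in D(A^{1/2})$ for every $t\ge0$ and every $\varepsilon\in(0,\varepsilon_0)$,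 and the same estimates hold with $\Gamma_{c,\varepsilon}$ instead of $\Gamma_{r,\varepsilon}$. -/

import Mathlib

open Set
open scoped RealInnerProductSpace

namespace WeakDissipation

noncomputable section

variable {H : Type*} [NormedAddCommGroup H] [InnerProductSpace ℝ H]

/-- The value `T x` of an unbounded operator, as a total function of `x : H`. It is used only at
points of the domain; outside the domain it is `0`. -/
def app (T : H →ₗ.[ℝ] H) (x : H) : H :=
  open Classical in if h : x ∈ T.domain then T ⟨x, h⟩ else 0

/-- `⟨T x, x⟩ ≥ 0` for every `x` in the domain. -/
def IsNonneg (T : H →ₗ.[ℝ] H) : Prop :=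
  ∀ x : T.domain, 0 ≤ ⟪T x, (x : H)⟫

/-- Coerciveness with constant `ν`: `ν > 0` and `⟨T x, x⟩ ≥ ν |x|²` for every `x` in the domain. -/
def IsCoercive (T : H →ₗ.[ℝ] H) (ν : ℝ) : Prop :=
  0 < ν ∧ ∀ x : T.domain, ν * ‖(x : H)‖ ^ 2 ≤ ⟪T x, (x : H)⟫

/-- `S` is a nonnegative self-adjoint square root of `A`: `A = S ∘ S` as unbounded operators, with
equality of domains, i.e. `D(A) = {x ∈ D(S) : S x ∈ D(S)}` and `A x = S (S x)` there. -/
def IsSqrt [CompleteSpace H] (A S : H →ₗ.[ℝ] H) : Prop :=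
  IsSelfAdjoint S ∧ IsNonneg S ∧
    ∀ x y : H, (x, y) ∈ A.graph ↔ ∃ z : H, (x, z) ∈ S.graph ∧ (z, y) ∈ S.graph

/-- The operator `A^{1/2}`: the nonnegative self-adjoint square root of `A`. Every nonnegative
self-adjoint `A` has exactly one; for operators without a square root the value is the dummy
operator `⊥` (the zero operator with domain `{0}`). -/
def sqrtOp [CompleteSpace H] (A : H →ₗ.[ℝ] H) : H →ₗ.[ℝ] H :=
  open Classical in if h : ∃ S : H →ₗ.[ℝ] H, IsSqrt A S then h.choose else ⊥

/-- `x ∈ D(A^{1/2})`. -/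
def MemDomHalf [CompleteSpace H] (A : H →ₗ.[ℝ] H) (x : H) : Prop :=
  x ∈ (sqrtOp A).domain

/-- `x ∈ D(A^{3/2})`: `x ∈ D(A)` and `A x ∈ D(A^{1/2})`. -/
def MemDomThreeHalves [CompleteSpace H] (A : H →ₗ.[ℝ] H) (x : H) : Prop :=
  x ∈ A.domain ∧ MemDomHalf A (app A x)

/-- `x ∈ D(A²)`: `x ∈ D(A)` and `A x ∈ D(A)`. -/
def MemDomTwo (A : H →ₗ.[ℝ] H) (x : H) : Prop :=
  x ∈ A.domain ∧ app A x ∈ A.domain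

/-- Derivative of a function defined on `[0, +∞)` (one-sided at `t = 0`). -/
def D {E : Type*} [NormedAddCommGroup E] [NormedSpace ℝ E] (v : ℝ → E) : ℝ → E :=
  derivWithin v (Ici 0)

/-- `v ∈ C^k([0, +∞); D(T))`, where `D(T)` carries the graph norm of the closed operator `T`:
this says that `t ↦ (v t, T (v t))` takes values in the graph of `T` and is of class `C^k`. -/
def IsCkInDomain (k : ℕ) (T : H →ₗ.[ℝ] H) (v : ℝ → H) : Prop :=
  (∀ t, 0 ≤ t → v t ∈ T.domain) ∧
    ContDiffOn ℝ k v (Ici 0) ∧ ContDiffOn ℝ k (fun t => app T (v t)) (Ici 0)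

/-- `u` is a global solution of `(1+t)^{-p} u' + c(t) A u = 0`, `u(0) = u₀`, in the class
`C¹([0,+∞); H) ∩ C⁰([0,+∞); D(A))`. -/
structure IsParabolicSolution (A : H →ₗ.[ℝ] H) (p : ℝ) (c : ℝ → ℝ) (u₀ : H) (u : ℝ → H) :
    Prop where
  contDiff : ContDiffOn ℝ 1 u (Ici 0)
  inDomain : IsCkInDomain 0 A u
  equation : ∀ t, 0 ≤ t → (1 / (1 + t) ^ p) • D u t + c t • app A (u t) = 0
  initial : u 0 = u₀

/-- `v` is a global solution of `ε v'' + (1+t)^{-p} v' + c(t) A v = 0`, `v(0) = u₀`,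
`v'(0) = u₁`, in the class
`C²([0,+∞); H) ∩ C¹([0,+∞); D(A^{1/2})) ∩ C⁰([0,+∞); D(A))`. -/
structure IsHyperbolicSolution [CompleteSpace H] (A : H →ₗ.[ℝ] H) (p ε : ℝ) (c : ℝ → ℝ)
    (u₀ u₁ : H) (v : ℝ → H) : Prop where
  contDiff : ContDiffOn ℝ 2 v (Ici 0)
  inDomainHalf : IsCkInDomain 1 (sqrtOp A) v
  inDomain : IsCkInDomain 0 A v
  equation : ∀ t, 0 ≤ t →
    ε • D (D v) t + (1 / (1 + t) ^ p) • D v t + c t • app A (v t) = 0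
  initial : v 0 = u₀
  initial_deriv : D v 0 = u₁

/-- `θ` is the corrector: `ε θ'' + (1+t)^{-p} θ' = 0`, `θ(0) = 0`, `θ'(0) = θ₀`. -/
structure IsCorrector (p ε : ℝ) (θ₀ : H) (θ : ℝ → H) : Prop where
  contDiff : ContDiffOn ℝ 2 θ (Ici 0)
  equation : ∀ t, 0 ≤ t → ε • D (D θ) t + (1 / (1 + t) ^ p) • D θ t = 0
  initial : θ 0 = 0
  initial_deriv : D θ 0 = θ₀

/-- The reduced quantity `|ρ|² + |A^{1/2} ρ|² + ε |r'|²`. -/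
def gammaReduced [CompleteSpace H] (A : H →ₗ.[ℝ] H) (ε : ℝ) (ρ r : ℝ → H) (t : ℝ) : ℝ :=
  ‖ρ t‖ ^ 2 + ‖app (sqrtOp A) (ρ t)‖ ^ 2 + ε * ‖D r t‖ ^ 2

/-- The complete quantity `|ρ|² + |A^{1/2} ρ|² + |A ρ|² + |r'|² + ε |A^{1/2} r'|²`. -/
def gammaComplete [CompleteSpace H] (A : H →ₗ.[ℝ] H) (ε : ℝ) (ρ r : ℝ → H) (t : ℝ) : ℝ :=
  ‖ρ t‖ ^ 2 + ‖app (sqrtOp A) (ρ t)‖ ^ 2 + ‖app A (ρ t)‖ ^ 2 + ‖D r t‖ ^ 2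
    + ε * ‖app (sqrtOp A) (D r t)‖ ^ 2

/-- There are `ε₁ ∈ (0, ε₀]` and `C` such that `Γ_ε(t) ≤ C ε² φ(t)` for every `t ≥ 0` and every
`ε ∈ (0, ε₁)`. -/
def ErrorBound (ε₀ : ℝ) (Γ : ℝ → ℝ → ℝ) (φ : ℝ → ℝ) : Prop :=
  ∃ ε₁ : ℝ, 0 < ε₁ ∧ ε₁ ≤ ε₀ ∧ ∃ C : ℝ,
    ∀ ε : ℝ, 0 < ε → ε < ε₁ → ∀ t : ℝ, 0 ≤ t → Γ ε t ≤ C * ε ^ 2 * φ t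

/-- The decay-error estimates in the three cases `p = 0`, `0 < p < 1`, `p = 1`. -/
def DecayErrorEstimates (p μ ν ε₀ : ℝ) (Γ : ℝ → ℝ → ℝ) : Prop :=
  (p = 0 → ∀ β : ℝ, β < 2 * μ * ν →
    ErrorBound ε₀ Γ (fun t => Real.exp (-β * t))) ∧
  (0 < p → p < 1 → ∀ β : ℝ, 0 < β →
    ErrorBound ε₀ Γ (fun t => Real.exp (-β * (1 + t) ^ (1 - p)))) ∧
  (p = 1 → ∀ β : ℝ, 0 < β →
    ErrorBound ε₀ Γ (fun t => 1 / (1 + t) ^ β))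

end

end WeakDissipation

/-! Write b = (1+t)^{-p}, B for its primitive vanishing at 0, s = r_ε' and τ = θ_ε'. Subtracting the
equations gives ρ' = s + τ and ε s' + b s + c_ε Aρ = F, where F = (c - c_ε) A u - ε u'' is of order
ε. The corrector is chosen so that ρ(0) = 0 and s(0) = 0; the only sources are then F and the
boundary layer τ = e^{-B/ε} θ₀.

The energy is E = ε|s|² + c_ε Q + K (b²|ρ|²/2 + ε b ⟨s,ρ⟩) with Q = |A^{1/2}ρ|². Its cross term
produces the dissipation K b c_ε Q. Since b²|ρ|² ≤ b² Q/ν, the dissipation dominates β b E, up to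
integrable multiples of E, as soon as β b² stays below 2μν with a margin (`rate_mul_energy_le`,
`IsAdmissibleRate.energy_inequality`). For p = 0 this means β < 2μν; for p > 0 it holds for large t
whatever β is, because b tends to 0.

The layer enters through (b/ε) e^{-B/(2ε)}, whose time integral is at most 2 for every ε. The term
u'' costs A²u and a factor b^{-2}; A²u is controlled in a weighted L² sense by the dissipation of
the parabolic energy, and powers of b are absorbed by a change of rate because e^{-B} ≤ b. A single
Lyapunov function collects these effects (`IsAdmissibleRate.error_decay`).

The solutions are not regular enough for these computations. They are performed on R u and R ρ,
where R is built from resolvents J = (1 + lA)⁻¹, commutes with A and makes A²R bounded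
(`errorSystem_of_solutions`). The constants depend on the data but not on l, so l → 0 is harmless.
The choice R = J³ gives the reduced estimate. The choice R = J² A^{1/2} J gives the terms A^{1/2}ρ,
Aρ and ε|A^{1/2}r'|² of the complete one. Its term |r'|², without the factor ε, comes from reading ε
s' + b s = F - c_ε Aρ as a first-order equation (`IsDissipation.velocity_decay`), and |ρ|² from
coerciveness. -/

open Filter Topology

namespace WeakDissipation

/-! ### Dissipation coefficients, admissible rates and pointwise energy inequalities -/

section

/-- A function with nonpositive one-sided derivative on `[0, ∞)` stays below its initial value. -/
theorem le_initial_of_hasDerivWithinAt_nonpos {f f' : ℝ → ℝ}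
    (hf : ∀ t, 0 ≤ t → HasDerivWithinAt f (f' t) (Ici 0) t)
    (hf' : ∀ t, 0 ≤ t → f' t ≤ 0) {t : ℝ} (ht : 0 ≤ t) : f t ≤ f 0 := by
  have h : AntitoneOn f (Ici 0) := by
    refine antitoneOn_of_deriv_nonpos (convex_Ici 0)
      (fun x hx => (hf x hx).continuousWithinAt) ?_ ?_
    · intro x hx
      rw [interior_Ici] at hx
      exact ((hf x hx.le).hasDerivAt (Ici_mem_nhds hx)).differentiableAt.differentiableWithinAt
    · intro x hx
      rw [interior_Ici] at hx
      rw [((hf x hx.le).hasDerivAt (Ici_mem_nhds hx)).deriv]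
      exact hf' x hx.le
  exact h self_mem_Ici ht ht

/-- The properties of the dissipation coefficient `b`, its derivative `b'` and its primitive `B`
that the energy estimates use. -/
structure IsDissipation (b b' B : ℝ → ℝ) : Prop where
  hasDeriv : ∀ t, 0 ≤ t → HasDerivWithinAt b (b' t) (Ici 0) t
  hasDeriv_primitive : ∀ t, 0 ≤ t → HasDerivWithinAt B (b t) (Ici 0) t
  pos : ∀ t, 0 ≤ t → 0 < b t
  le_one : ∀ t, 0 ≤ t → b t ≤ 1
  deriv_nonpos : ∀ t, 0 ≤ t → b' t ≤ 0
  neg_le_deriv : ∀ t, 0 ≤ t → -b t ≤ b' t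
  primitive_zero : B 0 = 0
  exp_le : ∀ t, 0 ≤ t → Real.exp (-B t) ≤ b t

theorem IsDissipation.primitive_nonneg {b b' B : ℝ → ℝ} (hb : IsDissipation b b' B) {t : ℝ}
    (ht : 0 ≤ t) : 0 ≤ B t := by
  have := (hb.exp_le t ht).trans (hb.le_one t ht)
  rw [Real.exp_le_one_iff] at this
  linarith

/-- `exp (-κ B)` is an admissible decay rate for a parabolic equation whose gap is `m / 2`. -/
def IsAdmissibleRate (b : ℝ → ℝ) (m κ : ℝ) : Prop :=
  ∃ η C : ℝ, 0 < η ∧ η < 1 ∧ 0 ≤ C ∧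
    ∀ t, 0 ≤ t → κ * b t ^ 2 ≤ m * (1 - η) + C * (b t * Real.exp (-t))

theorem mul_le_young {k : ℝ} (hk : 0 < k) (x y : ℝ) :
    x * y ≤ k / 2 * x ^ 2 + 1 / (2 * k) * y ^ 2 := by
  have h : k / 2 * x ^ 2 + 1 / (2 * k) * y ^ 2 - x * y = (k * x - y) ^ 2 / (2 * k) := by
    field_simp; ring
  have : 0 ≤ (k * x - y) ^ 2 / (2 * k) := by positivity
  linarith

section Pointwise

variable {H : Type*} [NormedAddCommGroup H] [InnerProductSpace ℝ H]

/-- The derivative of the hyperbolic energy, after the equation has been substituted. -/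
theorem energy_deriv_le {ε b b' c c' K ν M₃ M₄ Q q Θ : ℝ} {s ρ τ F a : H}
    (hε : 0 < ε) (hb : 0 < b) (hb1 : b ≤ 1) (hb' : b' ≤ 0) (hbb' : -b ≤ b') (hc : 0 < c)
    (hcM : c ≤ M₃) (hc' : |c'| ≤ M₄ * b) (hK : 0 < K) (hν : 0 < ν) (hQ : 0 ≤ Q)
    (hρQ : ν * ‖ρ‖ ^ 2 ≤ Q) (hq : 0 ≤ q) (hq1 : q ≤ 1) (hΘ : 0 ≤ Θ)
    (hτ : ‖τ‖ ≤ Θ * (b * q)) (haτ : |⟪a, τ⟫| ≤ √Q * (Θ * (b * q)))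
    (hKε : 4 * K * ε ≤ 1) (hKν : K * ε ≤ ν) :
    -2 * b * ‖s‖ ^ 2 + 2 * ⟪s, F⟫ + c' * Q + 2 * c * ⟪a, τ⟫
      + K * (b * b' * ‖ρ‖ ^ 2 + b ^ 2 * ⟪ρ, τ⟫ + ε * b' * ⟪s, ρ⟫ + b * ⟪F, ρ⟫ - b * c * Q
        + ε * b * ‖s‖ ^ 2 + ε * b * ⟪s, τ⟫)
    ≤ -b * ‖s‖ ^ 2 - b * Q * (K * c - M₄ - 1) + (b * q / ε) * Q * (M₃ + K / (2 * ν))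
      + ε * b * q * Θ ^ 2 * (M₃ + K) + (2 + K ^ 2 / (2 * ν)) * (‖F‖ ^ 2 / b) := by
  have hbq : 0 ≤ b * q := by positivity
  have hρQ' : ‖ρ‖ ^ 2 ≤ Q / ν := by rw [le_div_iff₀ hν]; linarith
  have hM₃ : 0 < M₃ := hc.trans_le hcM
  have t1 : 2 * ⟪s, F⟫ ≤ b / 2 * ‖s‖ ^ 2 + 2 * (‖F‖ ^ 2 / b) := by
    have h1 := real_inner_le_norm s F
    have h2 := mul_le_young (half_pos hb) ‖s‖ ‖F‖
    have h3 : 1 / (2 * (b / 2)) * ‖F‖ ^ 2 = ‖F‖ ^ 2 / b := by field_simp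
    linarith
  have t2 : c' * Q ≤ M₄ * b * Q :=
    mul_le_mul_of_nonneg_right ((le_abs_self _).trans hc') hQ
  -- Young's inequality with weight 1/ε. In the application q = exp(-B/(2ε)), so the factor b q/ε of
  -- `Q` has a time integral bounded independently of ε, and ε b q has one of order ε².
  have t3 : 2 * c * ⟪a, τ⟫ ≤ M₃ * (b * q / ε) * Q + M₃ * (ε * b * q * Θ ^ 2) := by
    have h1 : ⟪a, τ⟫ ≤ √Q * Θ * (b * q) := by
      have := (le_abs_self _).trans haτ; linarith
    have h2 := mul_le_young (one_div_pos.2 hε) √Q Θ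
    rw [Real.sq_sqrt hQ] at h2
    have h4 : 0 ≤ √Q * Θ * (b * q) := by positivity
    calc 2 * c * ⟪a, τ⟫ ≤ 2 * c * (√Q * Θ * (b * q)) := by gcongr
      _ ≤ 2 * M₃ * (√Q * Θ * (b * q)) := by gcongr
      _ ≤ 2 * M₃ * ((1 / ε / 2 * Q + 1 / (2 * (1 / ε)) * Θ ^ 2) * (b * q)) := by gcongr
      _ = _ := by field_simp
  have t4 : K * (b * b' * ‖ρ‖ ^ 2) ≤ 0 := by
    have : b * b' ≤ 0 := mul_nonpos_of_nonneg_of_nonpos hb.le hb'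
    have := mul_nonpos_of_nonpos_of_nonneg this (sq_nonneg ‖ρ‖)
    exact mul_nonpos_of_nonneg_of_nonpos hK.le this
  have t5 : K * (b ^ 2 * ⟪ρ, τ⟫) ≤ K / (2 * ν) * (b * q / ε) * Q
      + K / 2 * (ε * b * q * Θ ^ 2) := by
    have h1 : ⟪ρ, τ⟫ ≤ ‖ρ‖ * Θ * (b * q) := by
      have := real_inner_le_norm ρ τ
      have h2 : ‖ρ‖ * ‖τ‖ ≤ ‖ρ‖ * (Θ * (b * q)) := by gcongr
      linarith
    have h2 := mul_le_young (one_div_pos.2 hε) ‖ρ‖ Θ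
    have h4 : 0 ≤ ‖ρ‖ * Θ * (b * q) := by positivity
    calc K * (b ^ 2 * ⟪ρ, τ⟫) ≤ K * (b ^ 2 * (‖ρ‖ * Θ * (b * q))) := by gcongr
      _ ≤ K * (1 * (‖ρ‖ * Θ * (b * q))) := by
        gcongr
        exact pow_le_one₀ hb.le hb1
      _ ≤ K * (1 * ((1 / ε / 2 * ‖ρ‖ ^ 2 + 1 / (2 * (1 / ε)) * Θ ^ 2) * (b * q))) := by gcongr
      _ ≤ K * (1 * ((1 / ε / 2 * (Q / ν) + 1 / (2 * (1 / ε)) * Θ ^ 2) * (b * q))) := by gcongr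
      _ = _ := by field_simp
  have t6 : K * (ε * b' * ⟪s, ρ⟫) ≤ K * ε / 2 * b * ‖s‖ ^ 2 + 1 / 2 * (b * Q) := by
    have h1 : b' * ⟪s, ρ⟫ ≤ b * (‖s‖ * ‖ρ‖) := by
      refine (le_abs_self _).trans ?_
      rw [abs_mul]
      gcongr
      · rw [abs_le]; constructor <;> linarith
      · exact abs_real_inner_le_norm s ρ
    have h2 := mul_le_young one_pos ‖s‖ ‖ρ‖
    calc K * (ε * b' * ⟪s, ρ⟫) = K * ε * (b' * ⟪s, ρ⟫) := by ring
      _ ≤ K * ε * (b * (‖s‖ * ‖ρ‖)) := by gcongr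
      _ ≤ K * ε * (b * (1 / 2 * ‖s‖ ^ 2 + 1 / (2 * 1) * ‖ρ‖ ^ 2)) := by gcongr
      _ = K * ε / 2 * b * ‖s‖ ^ 2 + K * ε * (b * (1 / 2 * ‖ρ‖ ^ 2)) := by ring
      _ ≤ K * ε / 2 * b * ‖s‖ ^ 2 + ν * (b * (1 / 2 * ‖ρ‖ ^ 2)) := by gcongr
      _ = K * ε / 2 * b * ‖s‖ ^ 2 + 1 / 2 * (b * (ν * ‖ρ‖ ^ 2)) := by ring
      _ ≤ _ := by gcongr
  have t7 : K * (b * ⟪F, ρ⟫) ≤ 1 / 2 * (b * Q) + K ^ 2 / (2 * ν) * (‖F‖ ^ 2 / b) := by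
    have h1 := real_inner_le_norm F ρ
    have h2 := mul_le_young hν ‖ρ‖ (K * ‖F‖)
    have h3 : b ≤ 1 / b := by rw [le_div_iff₀ hb]; nlinarith
    calc K * (b * ⟪F, ρ⟫) ≤ K * (b * (‖F‖ * ‖ρ‖)) := by gcongr
      _ = b * (‖ρ‖ * (K * ‖F‖)) := by ring
      _ ≤ b * (ν / 2 * ‖ρ‖ ^ 2 + 1 / (2 * ν) * (K * ‖F‖) ^ 2) := by gcongr
      _ = 1 / 2 * (b * (ν * ‖ρ‖ ^ 2)) + K ^ 2 / (2 * ν) * (‖F‖ ^ 2 * b) := by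
        field_simp
      _ ≤ 1 / 2 * (b * Q) + K ^ 2 / (2 * ν) * (‖F‖ ^ 2 * (1 / b)) := by gcongr
      _ = _ := by field_simp
  have t8 : K * (ε * b * ⟪s, τ⟫) ≤ K * ε / 2 * b * ‖s‖ ^ 2 + K / 2 * (ε * b * q * Θ ^ 2) := by
    have h1 : ⟪s, τ⟫ ≤ ‖s‖ * (Θ * q) := by
      have := real_inner_le_norm s τ
      have h2 : ‖s‖ * ‖τ‖ ≤ ‖s‖ * (Θ * (1 * q)) :=
        mul_le_mul_of_nonneg_left (hτ.trans (by gcongr)) (norm_nonneg _)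
      linarith
    have h2 := mul_le_young one_pos ‖s‖ (Θ * q)
    have h3 : (Θ * q) ^ 2 ≤ Θ ^ 2 * q := by
      nlinarith [mul_nonneg (sq_nonneg Θ) (mul_nonneg hq (sub_nonneg.2 hq1))]
    calc K * (ε * b * ⟪s, τ⟫) ≤ K * (ε * b * (‖s‖ * (Θ * q))) := by gcongr
      _ ≤ K * (ε * b * (1 / 2 * ‖s‖ ^ 2 + 1 / (2 * 1) * (Θ * q) ^ 2)) := by gcongr
      _ ≤ K * (ε * b * (1 / 2 * ‖s‖ ^ 2 + 1 / (2 * 1) * (Θ ^ 2 * q))) := by gcongr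
      _ = _ := by ring
  -- The budget for |s|²: out of -2b|s|², b/2 pays for the source `F` and 2Kεb ≤ b/2 for the terms
  -- coming from the cross term, which leaves -b|s|².
  have t9 : 4 * K * ε * (b * ‖s‖ ^ 2) ≤ 1 * (b * ‖s‖ ^ 2) := by gcongr
  have e1 : -b * ‖s‖ ^ 2 - b * Q * (K * c - M₄ - 1) + (b * q / ε) * Q * (M₃ + K / (2 * ν))
      + ε * b * q * Θ ^ 2 * (M₃ + K) + (2 + K ^ 2 / (2 * ν)) * (‖F‖ ^ 2 / b)
      = -(b * ‖s‖ ^ 2) - K * (b * c * Q) + M₄ * b * Q + b * Q + M₃ * (b * q / ε) * Q +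
        K / (2 * ν) * (b * q / ε) * Q + M₃ * (ε * b * q * Θ ^ 2) + K / 2 * (ε * b * q * Θ ^ 2)
        + K / 2 * (ε * b * q * Θ ^ 2)
        + 2 * (‖F‖ ^ 2 / b) + K ^ 2 / (2 * ν) * (‖F‖ ^ 2 / b) := by ring
  rw [e1]
  linarith

/-- Two-sided control of the hyperbolic energy. -/
theorem energy_bounds {ε b c K ν μ Q : ℝ} {s ρ : H}
    (hε : 0 < ε) (hb : 0 < b) (hb1 : b ≤ 1) (hc : μ ≤ c)
    (hK : 0 < K) (hν : 0 < ν) (hQ : 0 ≤ Q)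
    (hρQ : ν * ‖ρ‖ ^ 2 ≤ Q) (hKε : K ^ 2 * ε ≤ μ * ν) :
    ε / 2 * ‖s‖ ^ 2 + μ / 2 * Q ≤
        ε * ‖s‖ ^ 2 + c * Q + K * (b ^ 2 / 2 * ‖ρ‖ ^ 2 + ε * b * ⟪s, ρ⟫) ∧
      ε * ‖s‖ ^ 2 + c * Q + K * (b ^ 2 / 2 * ‖ρ‖ ^ 2 + ε * b * ⟪s, ρ⟫) ≤
        3 / 2 * ε * ‖s‖ ^ 2 + c * Q + K ^ 2 * ε / (2 * ν) * Q + K * b ^ 2 / (2 * ν) * Q := by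
  have hρQ' : ‖ρ‖ ^ 2 ≤ Q / ν := by rw [le_div_iff₀ hν]; linarith
  have h1 : |K * (ε * b * ⟪s, ρ⟫)| ≤ ε / 2 * ‖s‖ ^ 2 + K ^ 2 * ε / (2 * ν) * Q := by
    have h2 := mul_le_young one_pos ‖s‖ (K * ‖ρ‖)
    calc |K * (ε * b * ⟪s, ρ⟫)| = K * (ε * b * |⟪s, ρ⟫|) := by
          rw [abs_mul, abs_mul, abs_of_pos hK, abs_of_pos (mul_pos hε hb)]
      _ ≤ K * (ε * 1 * (‖s‖ * ‖ρ‖)) := by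
          gcongr
          exact abs_real_inner_le_norm s ρ
      _ = ε * (‖s‖ * (K * ‖ρ‖)) := by ring
      _ ≤ ε * (1 / 2 * ‖s‖ ^ 2 + 1 / (2 * 1) * (K * ‖ρ‖) ^ 2) := by gcongr
      _ = ε / 2 * ‖s‖ ^ 2 + K ^ 2 * ε / 2 * ‖ρ‖ ^ 2 := by ring
      _ ≤ ε / 2 * ‖s‖ ^ 2 + K ^ 2 * ε / 2 * (Q / ν) := by gcongr
      _ = _ := by field_simp
  have h2 : K ^ 2 * ε / (2 * ν) * Q ≤ μ / 2 * Q := by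
    refine mul_le_mul_of_nonneg_right ?_ hQ
    rw [div_le_div_iff₀ (by positivity) (by positivity)]
    linarith
  have h3 : μ * Q ≤ c * Q := by gcongr
  have h4 : 0 ≤ K * (b ^ 2 / 2 * ‖ρ‖ ^ 2) := by positivity
  have h5 : K * (b ^ 2 / 2 * ‖ρ‖ ^ 2) ≤ K * b ^ 2 / (2 * ν) * Q := by
    calc K * (b ^ 2 / 2 * ‖ρ‖ ^ 2) ≤ K * (b ^ 2 / 2 * (Q / ν)) := by gcongr
      _ = _ := by field_simp
  rw [abs_le] at h1
  constructor <;> linarith [h1.1, h1.2]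

end Pointwise

end

/-! ### Decay of parabolic energies; derivative of the hyperbolic energy -/

section

/-- The functional `exp (κ B + C e^{-t}) P` for an admissible rate `κ` dissipates `Z`. -/
theorem IsAdmissibleRate.parabolic_deriv_le {b b' B : ℝ → ℝ} (hb : IsDissipation b b' B)
    {μ ν κ : ℝ} (hμ : 0 < μ) (hκ : IsAdmissibleRate b (2 * μ * ν) κ) :
    ∃ C δ : ℝ, 0 ≤ C ∧ 0 < δ ∧ ∀ P P' Z : ℝ → ℝ,
      (∀ t, 0 ≤ t → HasDerivWithinAt P (P' t) (Ici 0) t) →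
      (∀ t, 0 ≤ t → 0 ≤ P t) → (∀ t, 0 ≤ t → ν * P t ≤ Z t) → (∀ t, 0 ≤ t → 0 ≤ Z t) →
      (∀ t, 0 ≤ t → P' t ≤ -(2 * μ / b t) * Z t) →
      ∃ Y' : ℝ → ℝ,
        (∀ t, 0 ≤ t → HasDerivWithinAt (fun t => Real.exp (κ * B t + C * Real.exp (-t)) * P t)
          (Y' t) (Ici 0) t) ∧
        ∀ t, 0 ≤ t → Y' t ≤ -(δ * (Real.exp (κ * B t) * (Z t / b t))) := by
  obtain ⟨η, C, hη, hη1, hC, h⟩ := hκ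
  -- The derivative of the factor exp(C e^{-t}) cancels the part of the rate that exceeds the gap.
  -- The constant 2μη is the share of the dissipation that the admissible rate leaves unused.
  refine ⟨C, 2 * μ * η, hC, by positivity, fun P P' Z hP hP0 hPZ hZ hP' => ?_⟩
  refine ⟨fun t => Real.exp (κ * B t + C * Real.exp (-t)) *
    (κ * b t + C * (Real.exp (-t) * (-1))) * P t
      + Real.exp (κ * B t + C * Real.exp (-t)) * P' t, fun t ht => ?_, fun t ht => ?_⟩
  · have hB := hb.hasDeriv_primitive t ht
    have he : HasDerivWithinAt (fun t : ℝ => Real.exp (-t)) (Real.exp (-t) * (-1)) (Ici 0) t :=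
      ((hasDerivAt_id t).neg.exp).hasDerivWithinAt
    exact (((hB.const_mul κ).add (he.const_mul C)).exp).mul (hP t ht)
  · have hbt := hb.pos t ht
    have hZb : 0 ≤ Z t / b t := div_nonneg (hZ t ht) hbt.le
    have h1 : (κ * b t + C * (Real.exp (-t) * (-1))) * P t ≤ 2 * μ * (1 - η) * (Z t / b t) := by
      have h2 : κ * b t + C * (Real.exp (-t) * (-1)) ≤ 2 * μ * ν * (1 - η) / b t := by
        rw [le_div_iff₀ hbt]
        have := h t ht
        nlinarith
      calc _ ≤ 2 * μ * ν * (1 - η) / b t * P t := mul_le_mul_of_nonneg_right h2 (hP0 t ht)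
        _ = 2 * μ * (1 - η) / b t * (ν * P t) := by ring
        _ ≤ 2 * μ * (1 - η) / b t * Z t := by
          have : 0 ≤ 1 - η := by linarith
          exact mul_le_mul_of_nonneg_left (hPZ t ht) (by positivity)
        _ = _ := by ring
    have h3 : (κ * b t + C * (Real.exp (-t) * (-1))) * P t + P' t ≤
        -(2 * μ * η * (Z t / b t)) := by
      have := hP' t ht
      have h4 : -(2 * μ / b t) * Z t = -(2 * μ * (Z t / b t)) := by ring
      linarith
    have h5 : Real.exp (κ * B t) ≤ Real.exp (κ * B t + C * Real.exp (-t)) := by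
      rw [Real.exp_le_exp]
      have : 0 ≤ C * Real.exp (-t) := by positivity
      linarith
    calc _ = Real.exp (κ * B t + C * Real.exp (-t)) *
          ((κ * b t + C * (Real.exp (-t) * (-1))) * P t + P' t) := by ring
      _ ≤ Real.exp (κ * B t + C * Real.exp (-t)) * (-(2 * μ * η * (Z t / b t))) := by gcongr
      _ = -(2 * μ * η * (Real.exp (κ * B t + C * Real.exp (-t)) * (Z t / b t))) := by ring
      _ ≤ -(2 * μ * η * (Real.exp (κ * B t) * (Z t / b t))) := by gcongr

/-- Decay of a parabolic energy at an admissible rate. -/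
theorem IsAdmissibleRate.parabolic_decay {b b' B : ℝ → ℝ} (hb : IsDissipation b b' B)
    {μ ν κ : ℝ} (hμ : 0 < μ) (hκ : IsAdmissibleRate b (2 * μ * ν) κ) :
    ∃ C : ℝ, 0 < C ∧ ∀ P P' Z : ℝ → ℝ,
      (∀ t, 0 ≤ t → HasDerivWithinAt P (P' t) (Ici 0) t) →
      (∀ t, 0 ≤ t → 0 ≤ P t) → (∀ t, 0 ≤ t → ν * P t ≤ Z t) → (∀ t, 0 ≤ t → 0 ≤ Z t) →
      (∀ t, 0 ≤ t → P' t ≤ -(2 * μ / b t) * Z t) →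
      ∀ t, 0 ≤ t → P t ≤ C * P 0 * Real.exp (-κ * B t) := by
  obtain ⟨C, δ, hC, hδ, h⟩ := hκ.parabolic_deriv_le hb hμ
  refine ⟨Real.exp C, Real.exp_pos _, fun P P' Z hP hP0 hPZ hZ hP' t ht => ?_⟩
  obtain ⟨Y', hY, hY'⟩ := h P P' Z hP hP0 hPZ hZ hP'
  have h1 := le_initial_of_hasDerivWithinAt_nonpos hY (fun t ht => (hY' t ht).trans (by
    have := hb.pos t ht
    have := hZ t ht
    rw [neg_nonpos]; positivity)) ht
  simp only [hb.primitive_zero, mul_zero, neg_zero, Real.exp_zero, mul_one, zero_add] at h1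
  have h2 : Real.exp (κ * B t) * P t ≤ Real.exp (κ * B t + C * Real.exp (-t)) * P t := by
    refine mul_le_mul_of_nonneg_right (Real.exp_le_exp.2 ?_) (hP0 t ht)
    have : 0 ≤ C * Real.exp (-t) := by positivity
    linarith
  calc P t = Real.exp (κ * B t) * P t * Real.exp (-κ * B t) := by
        rw [mul_right_comm, ← Real.exp_add]; simp
    _ ≤ Real.exp C * P 0 * Real.exp (-κ * B t) :=
        mul_le_mul_of_nonneg_right (h2.trans h1) (Real.exp_pos _).le

variable {H : Type*} [NormedAddCommGroup H] [InnerProductSpace ℝ H]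

/-- The differentiated hyperbolic energy, with the equation substituted. -/
theorem hasDerivWithinAt_energy {ε K : ℝ} {b b' c c' Q : ℝ → ℝ} {s ρ : ℝ → H}
    {s' τ F a : H} {t : ℝ}
    (hb : HasDerivWithinAt b (b' t) (Ici 0) t) (hc : HasDerivWithinAt c (c' t) (Ici 0) t)
    (hρ : HasDerivWithinAt ρ (s t + τ) (Ici 0) t) (hs : HasDerivWithinAt s s' (Ici 0) t)
    (heq : ε • s' = F - b t • s t - c t • a)
    (hQ : HasDerivWithinAt Q (2 * ⟪a, s t + τ⟫) (Ici 0) t) (hQa : Q t = ⟪a, ρ t⟫) :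
    HasDerivWithinAt
      (fun t => ε * ‖s t‖ ^ 2 + c t * Q t + K * (b t ^ 2 / 2 * ‖ρ t‖ ^ 2 + ε * b t * ⟪s t, ρ t⟫))
      (-2 * b t * ‖s t‖ ^ 2 + 2 * ⟪s t, F⟫ + c' t * Q t + 2 * c t * ⟪a, τ⟫
      + K * (b t * b' t * ‖ρ t‖ ^ 2 + b t ^ 2 * ⟪ρ t, τ⟫ + ε * b' t * ⟪s t, ρ t⟫
        + b t * ⟪F, ρ t⟫ - b t * c t * Q t + ε * b t * ‖s t‖ ^ 2 + ε * b t * ⟪s t, τ⟫)) (Ici 0) t := by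
  have h := ((hs.norm_sq.const_mul ε).add (hc.mul hQ)).add
    (((((hb.pow 2).div_const 2).mul hρ.norm_sq).add
      ((hb.const_mul ε).mul (hs.inner ℝ hρ))).const_mul K)
  refine h.congr_deriv ?_
  have e1 : ε * ⟪s t, s'⟫ = ⟪s t, F⟫ - b t * ‖s t‖ ^ 2 - c t * ⟪s t, a⟫ := by
    rw [← real_inner_smul_right, heq, inner_sub_right, inner_sub_right, real_inner_smul_right,
      real_inner_smul_right, real_inner_self_eq_norm_sq]
  have e2 : ε * ⟪s', ρ t⟫ = ⟪F, ρ t⟫ - b t * ⟪s t, ρ t⟫ - c t * Q t := by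
    rw [← real_inner_smul_left, heq, inner_sub_left, inner_sub_left, real_inner_smul_left,
      real_inner_smul_left, hQa]
  simp only [inner_add_right, real_inner_self_eq_norm_sq, real_inner_comm a (s t),
    real_inner_comm (ρ t) (s t), Pi.pow_apply] at e1 e2 ⊢
  push_cast
  linear_combination 2 * e1 + K * b t * e2

end

/-! ### The error system and its energy inequality -/

section

variable {H : Type*} [NormedAddCommGroup H] [InnerProductSpace ℝ H]

/-- The error system of the singular perturbation, for fixed `ε`: `ρ` is the error, `s` its
derivative up to the corrector term `τ`, `a` stands for `A ρ`, `Q` for `⟨A ρ, ρ⟩`, and the source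
`F` is controlled by the dissipation `Z` of the parabolic energy `P`. -/
structure ErrorSystem (b B : ℝ → ℝ) (ν μ M₃ M₄ CF Θ P₀ ε : ℝ) (c c' Q P P' Z : ℝ → ℝ)
    (ρ s s' τ F a : ℝ → H) : Prop where
  coeff_deriv : ∀ t, 0 ≤ t → HasDerivWithinAt c (c' t) (Ici 0) t
  coeff_lower : ∀ t, 0 ≤ t → μ ≤ c t
  coeff_upper : ∀ t, 0 ≤ t → c t ≤ M₃
  coeff_deriv_le : ∀ t, 0 ≤ t → |c' t| ≤ M₄ * b t
  error_deriv : ∀ t, 0 ≤ t → HasDerivWithinAt ρ (s t + τ t) (Ici 0) t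
  velocity_deriv : ∀ t, 0 ≤ t → HasDerivWithinAt s (s' t) (Ici 0) t
  equation : ∀ t, 0 ≤ t → ε • s' t = F t - b t • s t - c t • a t
  form_deriv : ∀ t, 0 ≤ t → HasDerivWithinAt Q (2 * ⟪a t, s t + τ t⟫) (Ici 0) t
  form_eq : ∀ t, 0 ≤ t → Q t = ⟪a t, ρ t⟫
  form_coercive : ∀ t, 0 ≤ t → ν * ‖ρ t‖ ^ 2 ≤ Q t
  corrector_le : ∀ t, 0 ≤ t → ‖τ t‖ ≤ Θ * Real.exp (-B t / ε)
  inner_corrector_le : ∀ t, 0 ≤ t → |⟪a t, τ t⟫| ≤ √(Q t) * (Θ * Real.exp (-B t / ε))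
  error_zero : ρ 0 = 0
  velocity_zero : s 0 = 0
  source_le : ∀ t, 0 ≤ t → b t ^ 4 * ‖F t‖ ^ 2 ≤ ε ^ 2 * CF * Z t
  parabolic_deriv : ∀ t, 0 ≤ t → HasDerivWithinAt P (P' t) (Ici 0) t
  parabolic_nonneg : ∀ t, 0 ≤ t → 0 ≤ P t
  parabolic_coercive : ∀ t, 0 ≤ t → ν * P t ≤ Z t
  dissipation_nonneg : ∀ t, 0 ≤ t → 0 ≤ Z t
  parabolic_deriv_le : ∀ t, 0 ≤ t → P' t ≤ -(2 * μ / b t) * Z t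
  parabolic_initial : P 0 ≤ P₀

/-- The corrector's exponential, with a factor `b` split off. -/
theorem IsDissipation.exp_div_le {b b' B : ℝ → ℝ} (hb : IsDissipation b b' B) {ε : ℝ}
    (hε : 0 < ε) (hε2 : 2 * ε ≤ 1) {t : ℝ} (ht : 0 ≤ t) :
    Real.exp (-B t / ε) ≤ b t * Real.exp (-B t / (2 * ε)) := by
  have hB := hb.primitive_nonneg ht
  calc Real.exp (-B t / ε) = Real.exp (-B t / (2 * ε)) * Real.exp (-B t / (2 * ε)) := by
        rw [← Real.exp_add]; congr 1; field_simp; ring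
    _ ≤ Real.exp (-B t) * Real.exp (-B t / (2 * ε)) := by
        gcongr
        rw [div_le_iff₀ (by positivity)]
        nlinarith
    _ ≤ _ := by gcongr; exact hb.exp_le t ht

/-- The admissibility of `β` bounds `β b E` by the dissipation of the energy `E`. -/
theorem rate_mul_energy_le {β ε ν μ η C K M₄ c b Q E g x : ℝ} (hβ0 : 0 ≤ β) (hb : 0 < b)
    (hb1 : b ≤ 1) (hν : 0 < ν) (hK : 0 < K) (hC : 0 ≤ C) (hc : μ ≤ c) (hKβ : β ≤ K)
    (hKη : K * μ * η = β * μ + M₄ + 2) (hQ : 0 ≤ Q) (hx : 0 ≤ x) (hg : 0 ≤ g)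
    (k4 : β * (3 / 2 * ε) ≤ 1) (k5 : β * (K ^ 2 * ε / (2 * ν)) ≤ 1)
    (hadm : β * b ^ 2 ≤ 2 * μ * ν * (1 - η) + C * (b * g))
    (hup : E ≤ 3 / 2 * ε * x + c * Q + K ^ 2 * ε / (2 * ν) * Q + K * b ^ 2 / (2 * ν) * Q) :
    β * b * E ≤ b * x + b * Q * (K * c - M₄ - 1) + K * C / (2 * ν) * g * Q := by
  have u1 : β * b * E ≤ β * b * (3 / 2 * ε * x + c * Q
      + K ^ 2 * ε / (2 * ν) * Q + K * b ^ 2 / (2 * ν) * Q) := by gcongr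
  have u0 : β * b * (3 / 2 * ε * x + c * Q
      + K ^ 2 * ε / (2 * ν) * Q + K * b ^ 2 / (2 * ν) * Q) = β * (3 / 2 * ε) * (b * x)
      + β * c * (b * Q) + β * (K ^ 2 * ε / (2 * ν)) * (b * Q)
      + β * b ^ 2 * (K / (2 * ν) * (b * Q)) := by ring
  have u2 : β * (3 / 2 * ε) * (b * x) ≤ 1 * (b * x) := by gcongr
  have u3 : β * (K ^ 2 * ε / (2 * ν)) * (b * Q) ≤ 1 * (b * Q) := by gcongr
  -- This term limits β: admissibility bounds it by the share Kμ(1-η) of the dissipation coefficient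
  -- Kμ, plus a remainder with the integrable factor `g`.
  have u4 : β * b ^ 2 * (K / (2 * ν) * (b * Q)) ≤
      (2 * μ * ν * (1 - η) + C * (b * g)) * (K / (2 * ν) * (b * Q)) := by gcongr
  have u5 : (2 * μ * ν * (1 - η) + C * (b * g)) * (K / (2 * ν) * (b * Q)) =
      K * μ * (1 - η) * (b * Q) + b * b * (K * C / (2 * ν) * g * Q) := by
    field_simp
  have u6 : b * b * (K * C / (2 * ν) * g * Q) ≤ 1 * (K * C / (2 * ν) * g * Q) := by
    gcongr
    nlinarith
  -- The part β c of K c cancels the contribution of c Q to β b E exactly, so only (K - β) c has to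
  -- be compared with its lower bound; this is why β ≤ K is needed.
  have u7 : (K - β) * μ * (b * Q) ≤ (K - β) * c * (b * Q) := by
    have : 0 ≤ K - β := by linarith
    gcongr
  have u8 : K * μ * (1 - η) * (b * Q) = (K - β) * μ * (b * Q) - (M₄ + 2) * (b * Q) := by
    linear_combination -hKη * (b * Q)
  have u9 : b * Q * (K * c - M₄ - 1) = (K - β) * c * (b * Q) + β * c * (b * Q)
    - (M₄ + 1) * (b * Q) := by ring
  have u10 : (M₄ + 2) * (b * Q) = (M₄ + 1) * (b * Q) + b * Q := by ring
  linarith only [u0, u1, u2, u3, u4, u5, u6, u7, u8, u9, u10]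

/-- The energy inequality for an admissible rate `β`: up to integrable multiples of the energy and
the sources, the energy decays like `exp (-β B)`. -/
theorem IsAdmissibleRate.energy_inequality {b b' B : ℝ → ℝ} (hb : IsDissipation b b' B)
    {μ ν β M₃ M₄ : ℝ} (hμ : 0 < μ) (hν : 0 < ν) (hM₃ : 0 ≤ M₃) (hM₄ : 0 ≤ M₄) (hβ0 : 0 ≤ β)
    (hβ : IsAdmissibleRate b (2 * μ * ν) β) :
    ∃ K h₁ h₂ D₂ D₃ ε₁ : ℝ, 0 < K ∧ 0 ≤ h₁ ∧ 0 ≤ h₂ ∧ 0 ≤ D₂ ∧ 0 ≤ D₃ ∧ 0 < ε₁ ∧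
      ∀ (CF Θ P₀ ε : ℝ) (c c' Q P P' Z : ℝ → ℝ) (ρ s s' τ F a : ℝ → H), 0 ≤ Θ → 0 < ε → ε < ε₁ →
      ErrorSystem b B ν μ M₃ M₄ CF Θ P₀ ε c c' Q P P' Z ρ s s' τ F a →
      ∃ E E' : ℝ → ℝ, E 0 = 0 ∧
        (∀ t, 0 ≤ t → HasDerivWithinAt E (E' t) (Ici 0) t) ∧
        (∀ t, 0 ≤ t → ε / 2 * ‖s t‖ ^ 2 + μ / 2 * Q t ≤ E t) ∧
        ∀ t, 0 ≤ t → E' t + β * b t * E t ≤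
          h₁ * Real.exp (-t) * E t + h₂ * (b t * Real.exp (-B t / (2 * ε)) / ε) * E t
          + D₂ * Θ ^ 2 * (ε * b t * Real.exp (-B t / (2 * ε))) + D₃ * (‖F t‖ ^ 2 / b t) := by
  obtain ⟨η, C, hη, hη1, hC, hadm⟩ := hβ
  -- The margin Kμη has to pay for βμ, for the derivative of the coefficient (M₄), for the Young
  -- remainders (1) and for the ε-small part of the energy (1).
  obtain ⟨K, hKdef⟩ : ∃ K, K = (β * μ + M₄ + 2) / (μ * η) := ⟨_, rfl⟩
  have hK : 0 < K := by rw [hKdef]; positivity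
  have hKη : K * μ * η = β * μ + M₄ + 2 := by rw [hKdef]; field_simp
  have hKβ : β ≤ K := by
    have h1 : K * μ * η ≤ K * μ * 1 := by gcongr
    have h2 : β * μ ≤ K * μ := by linarith
    exact le_of_mul_le_mul_right h2 hμ
  -- The sum of all the thresholds: ε < 1/S gives every smallness condition at once.
  obtain ⟨S, hSdef⟩ : ∃ S, S = 2 + 4 * K + K / ν + K ^ 2 / (μ * ν) + 2 * β
    + β * K ^ 2 / (2 * ν) := ⟨_, rfl⟩
  have hS : 0 < S := by rw [hSdef]; positivity
  refine ⟨K, K * C / (2 * ν) * (2 / μ), (M₃ + K / (2 * ν)) * (2 / μ), M₃ + K,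
    2 + K ^ 2 / (2 * ν), 1 / S, hK, by positivity, by positivity, by positivity, by positivity,
    by positivity, fun CF Θ P₀ ε c c' Q P P' Z ρ s s' τ F a hΘ hε hε1 h => ?_⟩
  have hεS : ε * S < 1 := by rwa [lt_div_iff₀ hS] at hε1
  rw [hSdef] at hεS
  have n1 : 0 ≤ ε * (4 * K) := by positivity
  have n2 : 0 ≤ ε * (K / ν) := by positivity
  have n3 : 0 ≤ ε * (K ^ 2 / (μ * ν)) := by positivity
  have n4 : 0 ≤ ε * (2 * β) := by positivity
  have n5 : 0 ≤ ε * (β * K ^ 2 / (2 * ν)) := by positivity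
  have k0 : 2 * ε ≤ 1 := by linarith
  have k1 : 4 * K * ε ≤ 1 := by linarith
  have k2 : K * ε ≤ ν := by
    have : ε * (K / ν) ≤ 1 := by linarith
    rw [← mul_div_assoc, div_le_one hν] at this; linarith
  have k3 : K ^ 2 * ε ≤ μ * ν := by
    have : ε * (K ^ 2 / (μ * ν)) ≤ 1 := by linarith
    rw [← mul_div_assoc, div_le_one (by positivity)] at this; linarith
  have k4 : β * (3 / 2 * ε) ≤ 1 := by linarith
  have k5 : β * (K ^ 2 * ε / (2 * ν)) ≤ 1 := by
    have : β * (K ^ 2 * ε / (2 * ν)) = ε * (β * K ^ 2 / (2 * ν)) := by ring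
    linarith
  have hQ0 : ∀ t, 0 ≤ t → 0 ≤ Q t := fun t ht =>
    le_trans (by positivity) (h.form_coercive t ht)
  refine ⟨_, _, ?_, fun t ht => hasDerivWithinAt_energy (K := K) (hb.hasDeriv t ht)
    (h.coeff_deriv t ht) (h.error_deriv t ht) (h.velocity_deriv t ht) (h.equation t ht)
    (h.form_deriv t ht) (h.form_eq t ht), fun t ht => ?_, fun t ht => ?_⟩
  · simp [h.error_zero, h.velocity_zero, h.form_eq 0 le_rfl]
  · exact (energy_bounds hε (hb.pos t ht) (hb.le_one t ht) (h.coeff_lower t ht) hK hν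
      (hQ0 t ht) (h.form_coercive t ht) k3).1
  · have hbt := hb.pos t ht
    have hbt1 := hb.le_one t ht
    have hct := h.coeff_lower t ht
    have hQt := hQ0 t ht
    have hq1 : Real.exp (-B t / (2 * ε)) ≤ 1 := by
      rw [Real.exp_le_one_iff]
      exact div_nonpos_of_nonpos_of_nonneg (neg_nonpos.2 (hb.primitive_nonneg ht)) (by positivity)
    have hq0 := (Real.exp_pos (-B t / (2 * ε))).le
    have hexp := hb.exp_div_le hε k0 ht
    have hd := energy_deriv_le (s := s t) (ρ := ρ t) (τ := τ t) (F := F t) (a := a t) hε hbt hbt1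
      (hb.deriv_nonpos t ht) (hb.neg_le_deriv t ht) (hμ.trans_le hct) (h.coeff_upper t ht)
      (h.coeff_deriv_le t ht) hK hν hQt (h.form_coercive t ht) (Real.exp_pos _).le hq1 hΘ
      ((h.corrector_le t ht).trans (by gcongr))
      ((h.inner_corrector_le t ht).trans (by gcongr)) k1 k2
    obtain ⟨hlow, hup⟩ := energy_bounds (s := s t) hε hbt hbt1 hct hK hν hQt
      (h.form_coercive t ht) k3
    revert hd hlow hup
    generalize ε * ‖s t‖ ^ 2 + c t * Q t
      + K * (b t ^ 2 / 2 * ‖ρ t‖ ^ 2 + ε * b t * ⟪s t, ρ t⟫) = E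
    generalize Real.exp (-B t / (2 * ε)) = q at hq0 hq1
    intro hd hlow hup
    have hq : 0 ≤ b t * q / ε := by positivity
    have hQE : Q t ≤ 2 / μ * E := by
      have : μ / 2 * Q t ≤ E := by
        have : 0 ≤ ε / 2 * ‖s t‖ ^ 2 := by positivity
        linarith
      calc Q t = 2 / μ * (μ / 2 * Q t) := by field_simp
        _ ≤ _ := by gcongr
    have hE := rate_mul_energy_le (x := ‖s t‖ ^ 2) (M₄ := M₄) hβ0 hbt hbt1 hν hK hC hct hKβ hKη
      hQt (sq_nonneg _) (Real.exp_pos (-t)).le k4 k5 (hadm t ht) hup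
    have v1 : K * C / (2 * ν) * Real.exp (-t) * Q t ≤
        K * C / (2 * ν) * (2 / μ) * Real.exp (-t) * E := by
      calc _ ≤ K * C / (2 * ν) * Real.exp (-t) * (2 / μ * E) := by gcongr
        _ = _ := by ring
    have v2 : b t * q / ε * Q t * (M₃ + K / (2 * ν)) ≤
        (M₃ + K / (2 * ν)) * (2 / μ) * (b t * q / ε) * E := by
      calc _ ≤ b t * q / ε * (2 / μ * E) * (M₃ + K / (2 * ν)) := by gcongr
        _ = _ := by ring
    linarith only [hd, hE, v1, v2]

end

/-! ### Lyapunov functions: decay of the error and of the velocity -/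

section

variable {H : Type*} [NormedAddCommGroup H] [InnerProductSpace ℝ H]

/-- The weight `W` absorbing the integrable multiples of the energy in the energy inequality. -/
theorem hasDerivWithinAt_weight {b B : ℝ → ℝ} {t : ℝ} (hB : HasDerivWithinAt B (b t) (Ici 0) t)
    {ε : ℝ} (hε : 0 < ε) (β h₁ h₂ : ℝ) :
    HasDerivWithinAt
      (fun t => Real.exp (β * B t + h₁ * Real.exp (-t) + 2 * h₂ * Real.exp (-B t / (2 * ε))))
      (Real.exp (β * B t + h₁ * Real.exp (-t) + 2 * h₂ * Real.exp (-B t / (2 * ε))) *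
        (β * b t - h₁ * Real.exp (-t) - h₂ * (b t * Real.exp (-B t / (2 * ε)) / ε))) (Ici 0) t := by
  have he : HasDerivWithinAt (fun t : ℝ => Real.exp (-t)) (Real.exp (-t) * (-1)) (Ici 0) t :=
    ((hasDerivAt_id t).neg.exp).hasDerivWithinAt
  have hq := (hB.neg.div_const (2 * ε)).exp
  refine ((((hB.const_mul β).add (he.const_mul h₁)).add
    (hq.const_mul (2 * h₂))).exp).congr_deriv ?_
  simp only [Pi.add_apply, Pi.neg_apply]
  congr 1
  field_simp
  ring

/-- Decay of the error at every admissible rate `β` for which a slightly larger rate `κ` is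
admissible. -/
theorem IsAdmissibleRate.error_decay {b b' B : ℝ → ℝ} (hb : IsDissipation b b' B)
    {μ ν β κ M₃ M₄ CF Θ P₀ : ℝ} (hμ : 0 < μ) (hν : 0 < ν) (hM₃ : 0 ≤ M₃) (hM₄ : 0 ≤ M₄)
    (hβ0 : 0 ≤ β) (hβ : IsAdmissibleRate b (2 * μ * ν) β) (hκ : IsAdmissibleRate b (2 * μ * ν) κ)
    (hβκ : ∀ t, 0 ≤ t → Real.exp (β * B t) ≤ b t ^ 4 * Real.exp (κ * B t))
    (hCF : 0 ≤ CF) (hΘ : 0 ≤ Θ) :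
    ∃ ε₁ C : ℝ, 0 < ε₁ ∧
      ∀ (ε : ℝ) (c c' Q P P' Z : ℝ → ℝ) (ρ s s' τ F a : ℝ → H), 0 < ε → ε < ε₁ →
      ErrorSystem b B ν μ M₃ M₄ CF Θ P₀ ε c c' Q P P' Z ρ s s' τ F a →
      ∀ t, 0 ≤ t → ‖ρ t‖ ^ 2 + Q t + ε * ‖s t‖ ^ 2 ≤ C * ε ^ 2 * Real.exp (-β * B t) := by
  obtain ⟨K, h₁, h₂, D₂, D₃, ε₁, hK, hh₁, hh₂, hD₂, hD₃, hε₁, hen⟩ :=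
    hβ.energy_inequality (H := H) hb hμ hν hM₃ hM₄ hβ0
  obtain ⟨C₃, δ, hC₃, hδ, hpar⟩ := hκ.parabolic_deriv_le hb hμ
  -- The weight is at most w e^{βB}. The constants N₁ and N₂ make the decrease of the two auxiliary
  -- terms below compensate the layer and the source.
  set w := Real.exp (h₁ + 2 * h₂) with hw
  set N₁ := 4 * w * D₂ * Θ ^ 2 with hN₁
  set N₂ := w * D₃ * CF / δ with hN₂
  set N := N₁ + N₂ * (Real.exp C₃ * P₀) with hN
  have hN₂0 : 0 ≤ N₂ := by positivity
  refine ⟨min ε₁ (1 / (4 * (β + 1))), (2 / (μ * ν) + 2 / μ + 2) * N, by positivity,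
    fun ε c c' Q P P' Z ρ s s' τ F a hε hεlt h t ht => ?_⟩
  obtain ⟨E, E', hE0, hE, hElow, hE'⟩ := hen CF Θ P₀ ε c c' Q P P' Z ρ s s' τ F a hΘ hε
    (hεlt.trans_le (min_le_left _ _)) h
  obtain ⟨Y', hY, hY'⟩ := hpar P P' Z h.parabolic_deriv h.parabolic_nonneg h.parabolic_coercive
    h.dissipation_nonneg h.parabolic_deriv_le
  have hεβ : 4 * ε * β ≤ 1 := by
    have h1 := hεlt.trans_le (min_le_right _ _)
    rw [lt_div_iff₀ (by positivity)] at h1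
    nlinarith
  have hQ0 : ∀ t, 0 ≤ t → 0 ≤ Q t := fun t ht =>
    le_trans (by positivity) (h.form_coercive t ht)
  have hEnn : ∀ t, 0 ≤ t → 0 ≤ E t := fun t ht => by
    have := hElow t ht
    have := hQ0 t ht
    exact le_trans (by positivity) (hElow t ht)
  have hV : ∀ t, 0 ≤ t → HasDerivWithinAt (fun t => Real.exp ((β - 1 / (2 * ε)) * B t))
      (Real.exp ((β - 1 / (2 * ε)) * B t) * ((β - 1 / (2 * ε)) * b t)) (Ici 0) t :=
    fun t ht => ((hb.hasDeriv_primitive t ht).const_mul _).exp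
  -- The Lyapunov function is W E + N₁ε² exp((β - 1/(2ε))B) + N₂ε² exp(κB + C₃e^{-t}) P. Since E(0)
  -- = 0, it starts at order ε².
  have hmono := le_initial_of_hasDerivWithinAt_nonpos
    (fun t ht => (((hasDerivWithinAt_weight (hb.hasDeriv_primitive t ht) hε β h₁ h₂).mul
      (hE t ht)).add ((hV t ht).const_mul (N₁ * ε ^ 2))).add ((hY t ht).const_mul (N₂ * ε ^ 2)))
    (fun t ht => ?_) ht
  · simp only [Pi.add_apply, Pi.mul_apply, hE0, hb.primitive_zero, mul_zero, neg_zero,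
      Real.exp_zero, mul_one, zero_add] at hmono
    have hr : N₁ * ε ^ 2 + N₂ * ε ^ 2 * (Real.exp C₃ * P 0) ≤ N * ε ^ 2 := by
      have : N₂ * ε ^ 2 * (Real.exp C₃ * P 0) ≤ N₂ * ε ^ 2 * (Real.exp C₃ * P₀) := by
        gcongr
        exact h.parabolic_initial
      rw [hN]; linarith
    have hN₁0 : 0 ≤ N₁ * ε ^ 2 * Real.exp ((β - 1 / (2 * ε)) * B t) := by positivity
    have hN₂1 : 0 ≤ N₂ * ε ^ 2 * (Real.exp (κ * B t + C₃ * Real.exp (-t)) * P t) := by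
      have := h.parabolic_nonneg t ht
      positivity
    have hW : Real.exp (β * B t) * E t ≤ Real.exp (β * B t + h₁ * Real.exp (-t)
        + 2 * h₂ * Real.exp (-B t / (2 * ε))) * E t := by
      refine mul_le_mul_of_nonneg_right (Real.exp_le_exp.2 ?_) (hEnn t ht)
      have : 0 ≤ h₁ * Real.exp (-t) + 2 * h₂ * Real.exp (-B t / (2 * ε)) := by positivity
      linarith
    have hfin : Real.exp (β * B t) * E t ≤ N * ε ^ 2 := by linarith
    have hfin' : E t ≤ N * ε ^ 2 * Real.exp (-β * B t) := by
      calc E t = Real.exp (β * B t) * E t * Real.exp (-β * B t) := by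
            rw [mul_right_comm, ← Real.exp_add]; simp
        _ ≤ _ := mul_le_mul_of_nonneg_right hfin (Real.exp_pos _).le
    have hl := hElow t ht
    have hs0 : 0 ≤ ε / 2 * ‖s t‖ ^ 2 := by positivity
    have hQ1 := hQ0 t ht
    have hQE : Q t ≤ 2 / μ * E t := by
      have : μ / 2 * Q t ≤ E t := by linarith
      calc Q t = 2 / μ * (μ / 2 * Q t) := by field_simp
        _ ≤ _ := by gcongr
    have hρE : ‖ρ t‖ ^ 2 ≤ 2 / (μ * ν) * E t := by
      have h1 : ‖ρ t‖ ^ 2 ≤ Q t / ν := by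
        rw [le_div_iff₀ hν]; linarith [h.form_coercive t ht]
      calc ‖ρ t‖ ^ 2 ≤ Q t / ν := h1
        _ ≤ 2 / μ * E t / ν := by gcongr
        _ = _ := by field_simp
    have hsE : ε * ‖s t‖ ^ 2 ≤ 2 * E t := by
      have : 0 ≤ μ / 2 * Q t := by positivity
      linarith
    calc ‖ρ t‖ ^ 2 + Q t + ε * ‖s t‖ ^ 2 ≤ (2 / (μ * ν) + 2 / μ + 2) * E t := by
          linarith only [hQE, hρE, hsE]
      _ ≤ (2 / (μ * ν) + 2 / μ + 2) * (N * ε ^ 2 * Real.exp (-β * B t)) := by gcongr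
      _ = _ := by ring
  · have hbt := hb.pos t ht
    have hB0 := hb.primitive_nonneg ht
    have hZ := h.dissipation_nonneg t ht
    have hVq : Real.exp (β * B t) * Real.exp (-B t / (2 * ε)) =
        Real.exp ((β - 1 / (2 * ε)) * B t) := by
      rw [← Real.exp_add]; congr 1; field_simp; ring
    have hWle : Real.exp (β * B t + h₁ * Real.exp (-t) + 2 * h₂ * Real.exp (-B t / (2 * ε))) ≤
        w * Real.exp (β * B t) := by
      rw [hw, ← Real.exp_add, Real.exp_le_exp]
      have e1 : Real.exp (-t) ≤ 1 := by rw [Real.exp_le_one_iff]; linarith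
      have e2 : Real.exp (-B t / (2 * ε)) ≤ 1 := by
        rw [Real.exp_le_one_iff]
        exact div_nonpos_of_nonpos_of_nonneg (neg_nonpos.2 hB0) (by positivity)
      have := mul_le_mul_of_nonneg_left e1 hh₁
      have := mul_le_mul_of_nonneg_left e2 hh₂
      linarith
    -- The factor b⁴ gained by passing from β to κ is the one that the source bound requires.
    have s1 : w * D₃ * (Real.exp (β * B t) * (‖F t‖ ^ 2 / b t)) ≤
        N₂ * ε ^ 2 * (δ * (Real.exp (κ * B t) * (Z t / b t))) := by
      calc w * D₃ * (Real.exp (β * B t) * (‖F t‖ ^ 2 / b t))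
          ≤ w * D₃ * (b t ^ 4 * Real.exp (κ * B t) * (‖F t‖ ^ 2 / b t)) := by
            gcongr; exact hβκ t ht
        _ = w * D₃ * (Real.exp (κ * B t) * (b t ^ 4 * ‖F t‖ ^ 2 / b t)) := by ring
        _ ≤ w * D₃ * (Real.exp (κ * B t) * (ε ^ 2 * CF * Z t / b t)) :=
            mul_le_mul_of_nonneg_left (mul_le_mul_of_nonneg_left
              (div_le_div_of_nonneg_right (h.source_le t ht) hbt.le) (Real.exp_pos _).le)
              (by positivity)
        _ = _ := by rw [hN₂]; field_simp
    have s2 : N₂ * ε ^ 2 * Y' t ≤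
        N₂ * ε ^ 2 * (-(δ * (Real.exp (κ * B t) * (Z t / b t)))) := by
      gcongr; exact hY' t ht
    have s3 : N₁ * ε ^ 2 * (Real.exp ((β - 1 / (2 * ε)) * B t) * ((β - 1 / (2 * ε)) * b t)) ≤
        -(w * D₂ * Θ ^ 2 * (ε * b t * Real.exp ((β - 1 / (2 * ε)) * B t))) := by
      have e3 : β - 1 / (2 * ε) ≤ -(1 / (4 * ε)) := by
        have : β ≤ 1 / (4 * ε) := by rw [le_div_iff₀ (by positivity)]; linarith
        have e4 : 1 / (2 * ε) = 1 / (4 * ε) + 1 / (4 * ε) := by field_simp; norm_num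
        linarith
      calc _ ≤ N₁ * ε ^ 2 * (Real.exp ((β - 1 / (2 * ε)) * B t) * (-(1 / (4 * ε)) * b t)) := by
            gcongr
        _ = _ := by rw [hN₁]; field_simp
    have s4 : Real.exp (β * B t + h₁ * Real.exp (-t) + 2 * h₂ * Real.exp (-B t / (2 * ε))) *
        (D₂ * Θ ^ 2 * (ε * b t * Real.exp (-B t / (2 * ε))) + D₃ * (‖F t‖ ^ 2 / b t)) ≤
        w * D₂ * Θ ^ 2 * (ε * b t * Real.exp ((β - 1 / (2 * ε)) * B t))
        + w * D₃ * (Real.exp (β * B t) * (‖F t‖ ^ 2 / b t)) := by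
      calc _ ≤ w * Real.exp (β * B t) * (D₂ * Θ ^ 2 * (ε * b t * Real.exp (-B t / (2 * ε)))
            + D₃ * (‖F t‖ ^ 2 / b t)) := by gcongr
        _ = _ := by rw [← hVq]; ring
    have s5 := mul_le_mul_of_nonneg_left (hE' t ht) (Real.exp_pos (β * B t
      + h₁ * Real.exp (-t) + 2 * h₂ * Real.exp (-B t / (2 * ε)))).le
    linarith only [s1, s2, s3, s4, s5]

/-- Decay of the solution of a first-order singularly perturbed equation with small source. -/
theorem IsDissipation.velocity_decay {b b' B : ℝ → ℝ} (hb : IsDissipation b b' B) {β C ε : ℝ}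
    (hC : 0 ≤ C) (hε : 0 < ε) (hεβ : 2 * ε * β ≤ 1) {s s' G : ℝ → H}
    (hs : ∀ t, 0 ≤ t → HasDerivWithinAt s (s' t) (Ici 0) t)
    (heq : ∀ t, 0 ≤ t → ε • s' t = G t - b t • s t) (hs0 : s 0 = 0)
    (hG : ∀ t, 0 ≤ t → ‖G t‖ ^ 2 ≤ C * ε ^ 2 * (b t ^ 2 * Real.exp (-β * B t)))
    {t : ℝ} (ht : 0 ≤ t) : ‖s t‖ ^ 2 ≤ 2 * C * ε ^ 2 * Real.exp (-β * B t) := by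
  -- The function exp(B/(2ε)) (exp(βB)|s|² - 2Cε²) is nonincreasing and nonpositive at 0. Half of
  -- the damping 2b/ε absorbs the source; the rest is split between the rate β, using 2εβ ≤ 1, and
  -- the outer exponential.
  have hmono := le_initial_of_hasDerivWithinAt_nonpos
    (fun t ht => ((((hb.hasDeriv_primitive t ht).const_mul (1 / (2 * ε))).exp).mul
      (((((hb.hasDeriv_primitive t ht).const_mul β).exp).mul (hs t ht).norm_sq).sub_const
        (2 * C * ε ^ 2)))) (fun t ht => ?_) ht
  · simp only [Pi.mul_apply, hb.primitive_zero, mul_zero, Real.exp_zero, hs0, norm_zero] at hmono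
    have h1 : Real.exp (1 / (2 * ε) * B t) * (Real.exp (β * B t) * ‖s t‖ ^ 2 - 2 * C * ε ^ 2)
        ≤ 0 := by
      refine hmono.trans ?_
      have : 0 ≤ C * ε ^ 2 := by positivity
      norm_num
      linarith
    have h2 : Real.exp (β * B t) * ‖s t‖ ^ 2 - 2 * C * ε ^ 2 ≤ 0 := by
      by_contra! hcon
      exact absurd h1 (not_le.2 (mul_pos (Real.exp_pos _) hcon))
    calc ‖s t‖ ^ 2 = Real.exp (β * B t) * ‖s t‖ ^ 2 * Real.exp (-β * B t) := by
          rw [mul_right_comm, ← Real.exp_add]; simp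
      _ ≤ _ := mul_le_mul_of_nonneg_right (by linarith) (Real.exp_pos _).le
  · have hbt := hb.pos t ht
    have e1 : ε * ⟪s t, s' t⟫ = ⟪s t, G t⟫ - b t * ‖s t‖ ^ 2 := by
      rw [← real_inner_smul_right, heq t ht, inner_sub_right, real_inner_smul_right,
        real_inner_self_eq_norm_sq]
    have e2 : 2 * ⟪s t, s' t⟫ = 2 / ε * (⟪s t, G t⟫ - b t * ‖s t‖ ^ 2) := by
      rw [← e1]; field_simp
    have e3 : 2 / ε * ⟪s t, G t⟫ ≤ b t / ε * ‖s t‖ ^ 2 + C * ε * b t * Real.exp (-β * B t) := by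
      calc 2 / ε * ⟪s t, G t⟫ ≤ 2 / ε * (‖s t‖ * ‖G t‖) := by
            gcongr; exact real_inner_le_norm _ _
        _ ≤ 2 / ε * (b t / 2 * ‖s t‖ ^ 2 + 1 / (2 * b t) * ‖G t‖ ^ 2) := by
            gcongr; exact mul_le_young hbt _ _
        _ ≤ 2 / ε * (b t / 2 * ‖s t‖ ^ 2
            + 1 / (2 * b t) * (C * ε ^ 2 * (b t ^ 2 * Real.exp (-β * B t)))) := by
            gcongr; exact hG t ht
        _ = _ := by field_simp
    have e4 : β * b t * ‖s t‖ ^ 2 ≤ 1 / (2 * ε) * b t * ‖s t‖ ^ 2 := by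
      gcongr
      rw [le_div_iff₀ (by positivity)]; linarith
    have e5 : Real.exp (β * B t) * (β * b t * ‖s t‖ ^ 2 + 2 * ⟪s t, s' t⟫) ≤
        Real.exp (β * B t) * (-(1 / (2 * ε) * b t * ‖s t‖ ^ 2)
          + C * ε * b t * Real.exp (-β * B t)) := by
      refine mul_le_mul_of_nonneg_left ?_ (Real.exp_pos _).le
      have : 2 / ε * (⟪s t, G t⟫ - b t * ‖s t‖ ^ 2) = 2 / ε * ⟪s t, G t⟫
        - b t / ε * ‖s t‖ ^ 2 - 2 * (1 / (2 * ε) * b t * ‖s t‖ ^ 2) := by field_simp; ring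
      linarith only [this, e2, e3, e4]
    have e6 : Real.exp (β * B t) * Real.exp (-β * B t) = 1 := by
      rw [← Real.exp_add]; simp
    have e7 : 1 / (2 * ε) * b t * (Real.exp (β * B t) * ‖s t‖ ^ 2 - 2 * C * ε ^ 2)
        + Real.exp (β * B t) * (β * b t * ‖s t‖ ^ 2 + 2 * ⟪s t, s' t⟫) ≤ 0 := by
      have e8 : 1 / (2 * ε) * b t * (2 * C * ε ^ 2) = C * ε * b t := by field_simp
      have e9 : Real.exp (β * B t) * (-(1 / (2 * ε) * b t * ‖s t‖ ^ 2)
          + C * ε * b t * Real.exp (-β * B t)) =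
          -(1 / (2 * ε) * b t * (Real.exp (β * B t) * ‖s t‖ ^ 2)) + C * ε * b t := by
        linear_combination C * ε * b t * e6
      linarith only [e5, e8, e9]
    calc _ = Real.exp (1 / (2 * ε) * B t) *
        (1 / (2 * ε) * b t * (Real.exp (β * B t) * ‖s t‖ ^ 2 - 2 * C * ε ^ 2)
        + Real.exp (β * B t) * (β * b t * ‖s t‖ ^ 2 + 2 * ⟪s t, s' t⟫)) := by
          simp only [Pi.mul_apply]; ring
      _ ≤ 0 := mul_nonpos_of_nonneg_of_nonpos (Real.exp_pos _).le e7

end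

/-! ### Graphs of unbounded operators, resolvents and regularizers -/

section

variable {H : Type*} [NormedAddCommGroup H] [InnerProductSpace ℝ H]

theorem mem_graph_iff_app {T : H →ₗ.[ℝ] H} {x y : H} :
    (x, y) ∈ T.graph ↔ x ∈ T.domain ∧ app T x = y := by
  rw [LinearPMap.mem_graph_iff]
  constructor
  · rintro ⟨z, rfl, rfl⟩
    exact ⟨z.2, by simp [app]⟩
  · rintro ⟨hx, rfl⟩
    exact ⟨⟨x, hx⟩, rfl, by simp [app, hx]⟩

theorem mem_graph_app {T : H →ₗ.[ℝ] H} {x : H} (hx : x ∈ T.domain) : (x, app T x) ∈ T.graph :=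
  mem_graph_iff_app.2 ⟨hx, rfl⟩

theorem graph_unique {T : H →ₗ.[ℝ] H} {x y z : H} (hy : (x, y) ∈ T.graph)
    (hz : (x, z) ∈ T.graph) : y = z :=
  (mem_graph_iff_app.1 hy).2.symm.trans (mem_graph_iff_app.1 hz).2

theorem graph_add {T : H →ₗ.[ℝ] H} {x y x' y' : H} (h : (x, y) ∈ T.graph)
    (h' : (x', y') ∈ T.graph) : (x + x', y + y') ∈ T.graph :=
  T.graph.add_mem h h'

theorem graph_sub {T : H →ₗ.[ℝ] H} {x y x' y' : H} (h : (x, y) ∈ T.graph)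
    (h' : (x', y') ∈ T.graph) : (x - x', y - y') ∈ T.graph :=
  T.graph.sub_mem h h'

theorem graph_smul {T : H →ₗ.[ℝ] H} {x y : H} (k : ℝ) (h : (x, y) ∈ T.graph) :
    (k • x, k • y) ∈ T.graph :=
  T.graph.smul_mem k h

theorem IsCoercive.le_inner {A : H →ₗ.[ℝ] H} {ν : ℝ} (hA : IsCoercive A ν) {x y : H}
    (h : (x, y) ∈ A.graph) : ν * ‖x‖ ^ 2 ≤ ⟪y, x⟫ := by
  obtain ⟨z, rfl, rfl⟩ := (LinearPMap.mem_graph_iff A).1 h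
  exact hA.2 z

theorem IsCoercive.mul_norm_le {A : H →ₗ.[ℝ] H} {ν : ℝ} (hA : IsCoercive A ν) {x y : H}
    (h : (x, y) ∈ A.graph) : ν * ‖x‖ ≤ ‖y‖ := by
  rcases (norm_nonneg x).eq_or_lt with h0 | h0
  · simp [← h0]
  · have h1 := (hA.le_inner h).trans (real_inner_le_norm y x)
    exact le_of_mul_le_mul_right (by linarith) h0

/-- The difference d of the two solutions satisfies A d = -l⁻¹ d, which coerciveness excludes unless
d = 0. Writing the value of A as l⁻¹(f - y) puts the equation y + l A y = f into a single graph
membership. -/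
theorem resolvent_unique {A : H →ₗ.[ℝ] H} {ν : ℝ} (hν : IsCoercive A ν) {l : ℝ} (hl : 0 < l)
    {f y y' : H} (h : (y, l⁻¹ • (f - y)) ∈ A.graph) (h' : (y', l⁻¹ • (f - y')) ∈ A.graph) :
    y = y' := by
  have h1 := hν.le_inner (graph_sub h h')
  rw [← smul_sub, sub_sub_sub_cancel_left, ← neg_sub y y', smul_neg, inner_neg_left,
    real_inner_smul_left, real_inner_self_eq_norm_sq] at h1
  have h2 : 0 ≤ l⁻¹ * ‖y - y'‖ ^ 2 := by positivity
  have h3 : ‖y - y'‖ ^ 2 ≤ 0 := by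
    have := hν.1
    by_contra! hcon
    have := mul_pos this hcon
    linarith
  rw [← sub_eq_zero, ← norm_eq_zero]
  exact pow_eq_zero_iff two_ne_zero |>.1 (le_antisymm h3 (sq_nonneg _))

/-- `J = (1 + l A)⁻¹` and `K = A J`. -/
structure IsResolvent (A : H →ₗ.[ℝ] H) (l : ℝ) (J K : H →L[ℝ] H) : Prop where
  graph : ∀ x, (J x, K x) ∈ A.graph
  add_smul : ∀ x, J x + l • K x = x
  norm_le : ∀ x, ‖J x‖ ≤ ‖x‖

theorem IsResolvent.eq_inv_smul {A : H →ₗ.[ℝ] H} {l : ℝ} {J K : H →L[ℝ] H}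
    (h : IsResolvent A l J K) (hl : 0 < l) (x : H) :
    K x = l⁻¹ • (x - J x) := by
  rw [← eq_sub_of_add_eq' (h.add_smul x), inv_smul_smul₀ hl.ne']

theorem IsResolvent.unique {A : H →ₗ.[ℝ] H} {ν l : ℝ} {J K : H →L[ℝ] H}
    (h : IsResolvent A l J K) (hν : IsCoercive A ν) (hl : 0 < l) {f y : H}
    (hy : (y, l⁻¹ • (f - y)) ∈ A.graph) : y = J f :=
  resolvent_unique hν hl hy (h.eq_inv_smul hl f ▸ h.graph f)

/-- Bounded operators `R`, `K = A R`, `L = A² R` commuting with `A`. -/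
structure IsRegularizer (A : H →ₗ.[ℝ] H) (R K L : H →L[ℝ] H) : Prop where
  graph : ∀ x, (R x, K x) ∈ A.graph
  graph' : ∀ x, (K x, L x) ∈ A.graph
  comm : ∀ x y, (x, y) ∈ A.graph → K x = R y

theorem IsRegularizer.comm' {A : H →ₗ.[ℝ] H} {R K L : H →L[ℝ] H} (h : IsRegularizer A R K L)
    {x y : H} (hxy : (x, y) ∈ A.graph) : L x = K y :=
  graph_unique (h.graph' x) (h.comm x y hxy ▸ h.graph y)

/-- Third powers of contracting resolvents converge strongly to the identity. -/
theorem tendsto_resolvent_pow_three {J : ℕ → H →L[ℝ] H} (hn : ∀ n x, ‖J n x‖ ≤ ‖x‖)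
    (h : ∀ x, Tendsto (fun n => J n x) atTop (𝓝 x)) (x : H) :
    Tendsto (fun n => J n (J n (J n x))) atTop (𝓝 x) := by
  have h0 : Tendsto (fun n => 3 * ‖J n x - x‖) atTop (𝓝 0) := by
    have := ((tendsto_iff_norm_sub_tendsto_zero.1 (h x)).const_mul 3)
    simpa using this
  rw [tendsto_iff_norm_sub_tendsto_zero]
  refine squeeze_zero (fun n => norm_nonneg _) (fun n => ?_) h0
  have e : J n (J n (J n x)) - x = J n (J n (J n x - x)) + J n (J n x - x) + (J n x - x) := by
    simp only [map_sub]; abel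
  have h1 := hn n (J n (J n x - x))
  have h2 := hn n (J n x - x)
  rw [e]
  have h3 := norm_add_le (J n (J n (J n x - x)) + J n (J n x - x)) (J n x - x)
  have h4 := norm_add_le (J n (J n (J n x - x))) (J n (J n x - x))
  linarith

variable [CompleteSpace H]

theorem inner_graph_comm {A : H →ₗ.[ℝ] H} (hA : IsSelfAdjoint A) {x y x' y' : H}
    (h : (x, y) ∈ A.graph) (h' : (x', y') ∈ A.graph) : ⟪y, x'⟫ = ⟪x, y'⟫ := by
  have hd := hA.dense_domain
  have hf := LinearPMap.adjoint_isFormalAdjoint hd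
  rw [LinearPMap.isSelfAdjoint_def.1 hA] at hf
  obtain ⟨z, rfl, rfl⟩ := (LinearPMap.mem_graph_iff A).1 h
  obtain ⟨z', rfl, rfl⟩ := (LinearPMap.mem_graph_iff A).1 h'
  exact hf z z'

/-- A self-adjoint operator is maximal. -/
theorem mem_graph_of_inner {A : H →ₗ.[ℝ] H} (hA : IsSelfAdjoint A) {x y : H}
    (h : ∀ x' y', (x', y') ∈ A.graph → ⟪y, x'⟫ = ⟪x, y'⟫) : (x, y) ∈ A.graph := by
  have hd := hA.dense_domain
  have h' : ∀ z : A.domain, ⟪y, z⟫ = ⟪x, A z⟫ := fun z => h _ _ (A.mem_graph z)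
  have hx : x ∈ A.adjoint.domain := LinearPMap.mem_adjoint_domain_of_exists x ⟨y, h'⟩
  have hg : (x, y) ∈ A.adjoint.graph :=
    (LinearPMap.mem_graph_iff _).2 ⟨⟨x, hx⟩, rfl, LinearPMap.adjoint_apply_eq hd ⟨x, hx⟩ h'⟩
  rwa [LinearPMap.isSelfAdjoint_def.1 hA] at hg

/-- Membership in the domain of a self-adjoint operator from a bound on the weak action. -/
theorem mem_domain_of_abs_inner_le {A : H →ₗ.[ℝ] H} (hA : IsSelfAdjoint A) {x : H} (C : ℝ)
    (h : ∀ x' y', (x', y') ∈ A.graph → |⟪x, y'⟫| ≤ C * ‖x'‖) : x ∈ A.domain := by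
  have hx : x ∈ A.adjoint.domain := by
    rw [LinearPMap.mem_adjoint_domain_iff]
    exact AddMonoidHomClass.continuous_of_bound _ C fun z => h _ _ (A.mem_graph z)
  rwa [LinearPMap.isSelfAdjoint_def.1 hA] at hx

/-- The graph of A is closed, hence complete, and 1 + lA is bounded below on it, so the range is
closed. A vector z orthogonal to the range lies in the domain of the adjoint, which is A, and A z =
-l⁻¹ z; coerciveness then gives z = 0. -/
theorem resolvent_surjective {A : H →ₗ.[ℝ] H} (hA : IsSelfAdjoint A) {ν : ℝ}
    (hν : IsCoercive A ν) {l : ℝ} (hl : 0 < l) (f : H) :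
    ∃ y z, (y, z) ∈ A.graph ∧ y + l • z = f := by
  let Φ : A.graph →L[ℝ] H :=
    (ContinuousLinearMap.fst ℝ H H + l • ContinuousLinearMap.snd ℝ H H).comp A.graph.subtypeL
  have hΦ : ∀ w : A.graph, Φ w = w.1.1 + l • w.1.2 := fun w => rfl
  have hbound : ∀ w : A.graph, ‖w‖ ≤ max 1 (2 / l) * ‖Φ w‖ := by
    intro w
    have hw : (w.1.1, w.1.2) ∈ A.graph := w.2
    have h1 : ‖w.1.1‖ ≤ ‖Φ w‖ := by
      have h2 : ‖w.1.1‖ ^ 2 ≤ ⟪Φ w, w.1.1⟫ := by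
        rw [hΦ, inner_add_left, real_inner_smul_left, real_inner_self_eq_norm_sq]
        have h3 := hν.le_inner hw
        have h4 : 0 ≤ ν * ‖w.1.1‖ ^ 2 := mul_nonneg hν.1.le (sq_nonneg _)
        have : 0 ≤ l * ⟪w.1.2, w.1.1⟫ := mul_nonneg hl.le (h4.trans h3)
        linarith
      rcases (norm_nonneg w.1.1).eq_or_lt with h0 | h0
      · rw [← h0]; positivity
      · have := h2.trans (real_inner_le_norm _ _)
        exact le_of_mul_le_mul_right (by linarith) h0
    have h2 : ‖w.1.2‖ ≤ 2 / l * ‖Φ w‖ := by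
      have h3 : l • w.1.2 = Φ w - w.1.1 := by rw [hΦ]; abel
      have h4 : l * ‖w.1.2‖ ≤ 2 * ‖Φ w‖ := by
        rw [← Real.norm_of_nonneg hl.le, ← norm_smul, h3]
        linarith [norm_sub_le (Φ w) w.1.1]
      rw [div_mul_eq_mul_div, le_div_iff₀ hl]; linarith
    rw [Submodule.coe_norm, Prod.norm_def]
    refine max_le (h1.trans ?_) (h2.trans ?_)
    · exact le_mul_of_one_le_left (norm_nonneg _) (le_max_left _ _)
    · gcongr; exact le_max_right _ _
  have hgc : IsClosed (A.graph : Set (H × H)) := hA.isClosed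
  have : CompleteSpace A.graph := hgc.completeSpace_coe
  have hanti : AntilipschitzWith (max 1 (2 / l)).toNNReal Φ :=
    ContinuousLinearMap.antilipschitz_of_bound Φ fun w => by
      rw [Real.coe_toNNReal _ (by positivity)]; exact hbound w
  have hclosed : IsClosed (Φ.range : Set H) := by
    have := hanti.isClosed_range Φ.uniformContinuous
    exact this
  have : CompleteSpace Φ.range := hclosed.completeSpace_coe
  have htop : Φ.range = ⊤ := by
    rw [← Submodule.orthogonal_eq_bot_iff, Submodule.eq_bot_iff]
    intro z hz
    have hz' : ∀ x' y', (x', y') ∈ A.graph → ⟪-(l⁻¹ • z), x'⟫ = ⟪z, y'⟫ := by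
      intro x' y' h
      have := (Submodule.mem_orthogonal _ _).1 hz (Φ ⟨(x', y'), h⟩) ⟨_, rfl⟩
      rw [hΦ, inner_add_left, real_inner_smul_left] at this
      rw [inner_neg_left, real_inner_smul_left, real_inner_comm x' z, real_inner_comm y' z]
      field_simp
      simp only at this
      linarith
    have h1 := hν.le_inner (mem_graph_of_inner hA hz')
    rw [inner_neg_left, real_inner_smul_left, real_inner_self_eq_norm_sq] at h1
    have h2 : 0 ≤ l⁻¹ * ‖z‖ ^ 2 := by positivity
    have h3 : ‖z‖ ^ 2 ≤ 0 := by
      have := hν.1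
      by_contra! hcon
      have := mul_pos this hcon
      linarith
    rw [← norm_eq_zero]
    exact pow_eq_zero_iff two_ne_zero |>.1 (le_antisymm h3 (sq_nonneg _))
  obtain ⟨w, hw⟩ : f ∈ Φ.range := htop ▸ Submodule.mem_top
  exact ⟨w.1.1, w.1.2, w.2, hw⟩

theorem exists_isResolvent {A : H →ₗ.[ℝ] H} (hA : IsSelfAdjoint A) {ν : ℝ}
    (hν : IsCoercive A ν) {l : ℝ} (hl : 0 < l) : ∃ J K, IsResolvent A l J K := by
  choose j k hjk hsum using resolvent_surjective hA hν hl
  have hk : ∀ x, k x = l⁻¹ • (x - j x) := fun x => by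
    rw [← eq_sub_of_add_eq' (hsum x), inv_smul_smul₀ hl.ne']
  have hg : ∀ x, (j x, l⁻¹ • (x - j x)) ∈ A.graph := fun x => hk x ▸ hjk x
  have hnorm : ∀ x, ‖j x‖ ≤ ‖x‖ := by
    intro x
    have h2 : ‖j x‖ ^ 2 ≤ ⟪x, j x⟫ := by
      conv_rhs => rw [← hsum x]
      rw [inner_add_left, real_inner_smul_left, hsum x, real_inner_self_eq_norm_sq]
      have h4 : 0 ≤ ν * ‖j x‖ ^ 2 := mul_nonneg hν.1.le (sq_nonneg _)
      have : 0 ≤ l * ⟪k x, j x⟫ := mul_nonneg hl.le (h4.trans (hν.le_inner (hjk x)))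
      linarith
    rcases (norm_nonneg (j x)).eq_or_lt with h0 | h0
    · rw [← h0]; positivity
    · have := h2.trans (real_inner_le_norm _ _)
      exact le_of_mul_le_mul_right (by linarith) h0
  -- Linearity is inherited from the uniqueness of solutions of the resolvent equation.
  let J₀ : H →ₗ[ℝ] H :=
    { toFun := j
      map_add' := fun x y => resolvent_unique hν hl (hg (x + y)) (by
        have := graph_add (hg x) (hg y)
        rwa [← smul_add, sub_add_sub_comm] at this)
      map_smul' := fun a x => resolvent_unique hν hl (hg (a • x)) (by
        have := graph_smul a (hg x)
        rwa [smul_comm, smul_sub] at this) }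
  let J : H →L[ℝ] H := J₀.mkContinuous 1 fun x => (hnorm x).trans (one_mul ‖x‖).ge
  have hJ : ∀ x, J x = j x := fun x => rfl
  refine ⟨J, l⁻¹ • (ContinuousLinearMap.id ℝ H - J), fun x => ?_, fun x => ?_, hnorm⟩
  · exact hg x
  · simp [smul_inv_smul₀ hl.ne']

section Resolvent

variable {A S : H →ₗ.[ℝ] H} {ν l : ℝ} {J K T : H →L[ℝ] H}

/-- The resolvent commutes with `A`. -/
theorem IsResolvent.comm (h : IsResolvent A l J K) (hν : IsCoercive A ν) (hl : 0 < l) {x y : H}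
    (hxy : (x, y) ∈ A.graph) : K x = J y := by
  refine h.unique hν hl ?_
  have := graph_smul l⁻¹ (graph_sub hxy (h.graph x))
  rwa [← h.eq_inv_smul hl] at this

theorem IsResolvent.map_graph (h : IsResolvent A l J K) (hν : IsCoercive A ν) (hl : 0 < l)
    {x y : H} (hxy : (x, y) ∈ A.graph) : (J x, J y) ∈ A.graph :=
  h.comm hν hl hxy ▸ h.graph x

/-- The resolvent commutes with the square root. -/
theorem IsResolvent.map_sqrt (h : IsResolvent A l J K) (hν : IsCoercive A ν) (hl : 0 < l)
    (hS : IsSqrt A S) {x y : H} (hxy : (x, y) ∈ S.graph) : (J x, J y) ∈ S.graph := by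
  obtain ⟨z, hz, hz'⟩ := (hS.2.2 _ _).1 (h.graph x)
  -- With z = S J x one has S z = K x = l⁻¹(x - J x), so A z = S K x = l⁻¹(y - z): z solves the
  -- resolvent equation with datum y.
  have h1 : (K x, l⁻¹ • (y - z)) ∈ S.graph := by
    rw [h.eq_inv_smul hl]
    exact graph_smul _ (graph_sub hxy hz)
  have : z = J y := h.unique hν hl ((hS.2.2 _ _).2 ⟨_, hz', h1⟩)
  rwa [← this]

/-- `A^{1/2} J` is a bounded operator. -/
theorem IsResolvent.exists_sqrt_comp (h : IsResolvent A l J K) (hS : IsSqrt A S) :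
    ∃ T : H →L[ℝ] H, ∀ x, (J x, T x) ∈ S.graph ∧ (T x, K x) ∈ S.graph := by
  choose j hj hj' using fun x => (hS.2.2 _ _).1 (h.graph x)
  let T₀ : H →ₗ[ℝ] H :=
    { toFun := j
      map_add' := fun x y => graph_unique (hj (x + y)) (by
        rw [map_add]; exact graph_add (hj x) (hj y))
      map_smul' := fun a x => graph_unique (hj (a • x)) (by
        rw [map_smul]; exact graph_smul a (hj x)) }
  have hb : ∀ x, ‖T₀ x‖ ≤ (1 + ‖K‖) * ‖x‖ := by
    intro x
    refine abs_le_of_sq_le_sq' ?_ (by positivity) |>.2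
    have h1 : ‖T₀ x‖ ^ 2 = ⟪J x, K x⟫ := by
      rw [← real_inner_self_eq_norm_sq]
      exact inner_graph_comm hS.1 (hj x) (hj' x)
    rw [h1]
    calc ⟪J x, K x⟫ ≤ ‖J x‖ * ‖K x‖ := real_inner_le_norm _ _
      _ ≤ ‖x‖ * (‖K‖ * ‖x‖) := by
        gcongr
        · exact h.norm_le x
        · exact K.le_opNorm x
      _ ≤ ((1 + ‖K‖) * ‖x‖) ^ 2 := by
        have : 0 ≤ ‖K‖ := norm_nonneg _
        nlinarith [sq_nonneg ‖x‖, mul_nonneg this (sq_nonneg ‖x‖),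
          mul_nonneg (mul_nonneg this this) (sq_nonneg ‖x‖)]
  exact ⟨T₀.mkContinuous _ hb, fun x => ⟨hj x, hj' x⟩⟩

theorem IsResolvent.sqrt_comp_map_graph (h : IsResolvent A l J K) (hν : IsCoercive A ν)
    (hl : 0 < l) (hS : IsSqrt A S) (hT : ∀ x, (J x, T x) ∈ S.graph ∧ (T x, K x) ∈ S.graph)
    {x y : H} (hxy : (x, y) ∈ A.graph) : (T x, T y) ∈ A.graph :=
  (hS.2.2 _ _).2 ⟨K x, (hT x).2, h.comm hν hl hxy ▸ (hT y).1⟩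

end Resolvent

/-- Two resolvent factors make A² bounded, and the third factor only has to commute with A. It is J
for estimates on ρ, and A^{1/2}J for estimates on A^{1/2}ρ. -/
theorem IsResolvent.isRegularizer {A : H →ₗ.[ℝ] H} {ν l : ℝ} {J K : H →L[ℝ] H}
    (h : IsResolvent A l J K) (hν : IsCoercive A ν) (hl : 0 < l) {V : H →L[ℝ] H}
    (hV : ∀ x y, (x, y) ∈ A.graph → (V x, V y) ∈ A.graph) :
    IsRegularizer A (J ∘L J ∘L V) (K ∘L J ∘L V) (K ∘L K ∘L V) where
  graph x := h.graph _
  graph' x := by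
    simp only [ContinuousLinearMap.comp_apply]
    rw [h.comm hν hl (h.graph (V x))]
    exact h.graph _
  comm x y hxy := by
    simp only [ContinuousLinearMap.comp_apply]
    rw [h.comm hν hl (h.graph (V x)), h.comm hν hl (hV x y hxy)]

/-- Resolvents converge strongly to the identity. -/
theorem tendsto_resolvent {A : H →ₗ.[ℝ] H} (hA : IsSelfAdjoint A) {ν : ℝ}
    (hν : IsCoercive A ν) {l : ℕ → ℝ} (hl : ∀ n, 0 < l n) (hl0 : Tendsto l atTop (𝓝 0))
    {J K : ℕ → H →L[ℝ] H} (h : ∀ n, IsResolvent A (l n) (J n) (K n)) (x : H) :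
    Tendsto (fun n => J n x) atTop (𝓝 x) := by
  rw [Metric.tendsto_atTop]
  intro δ hδ
  obtain ⟨y, hy, hxy⟩ := Metric.mem_closure_iff.1 (hA.dense_domain x) (δ / 3) (by positivity)
  rw [dist_eq_norm] at hxy
  have h1 : Tendsto (fun n => l n * ‖app A y‖) atTop (𝓝 0) := by
    simpa using hl0.mul_const ‖app A y‖
  obtain ⟨N, hN⟩ := (Metric.tendsto_atTop.1 h1) (δ / 3) (by positivity)
  refine ⟨N, fun n hn => ?_⟩
  have h2 := hN n hn
  rw [Real.dist_0_eq_abs, abs_of_nonneg (mul_nonneg (hl n).le (norm_nonneg _))] at h2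
  have h3 : ‖J n y - y‖ ≤ l n * ‖app A y‖ := by
    have h4 : J n y - y = -(l n • K n y) := by
      have := (h n).add_smul y
      rw [← eq_sub_iff_add_eq] at this
      rw [this]; abel
    rw [h4, norm_neg, norm_smul, Real.norm_of_nonneg (hl n).le,
      (h n).comm hν (hl n) (mem_graph_app hy)]
    exact mul_le_mul_of_nonneg_left ((h n).norm_le _) (hl n).le
  have h5 : J n x - x = J n (x - y) + (J n y - y) - (x - y) := by
    rw [map_sub]; abel
  rw [dist_eq_norm, h5]
  have h6 := (h n).norm_le (x - y)
  have h7 := norm_sub_le (J n (x - y) + (J n y - y)) (x - y)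
  have h8 := norm_add_le (J n (x - y)) (J n y - y)
  linarith

end

/-! ### Regularized solutions satisfy the error system -/

section

section Derivatives

variable {E : Type*} [NormedAddCommGroup E] [NormedSpace ℝ E]

theorem hasDerivWithinAt_D {v : ℝ → E} (hv : ContDiffOn ℝ 1 v (Ici 0)) {t : ℝ} (ht : 0 ≤ t) :
    HasDerivWithinAt v (D v t) (Ici 0) t :=
  (hv.differentiableOn one_ne_zero t ht).hasDerivWithinAt

theorem contDiffOn_D {v : ℝ → E} (hv : ContDiffOn ℝ 2 v (Ici 0)) :
    ContDiffOn ℝ 1 (D v) (Ici 0) :=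
  hv.derivWithin (uniqueDiffOn_Ici 0) (by norm_num)

theorem D_eq {v : ℝ → E} {v' : E} {t : ℝ} (ht : 0 ≤ t) (h : HasDerivWithinAt v v' (Ici 0) t) :
    D v t = v' :=
  h.derivWithin (uniqueDiffOn_Ici 0 t ht)

theorem eq_initial_of_hasDerivWithinAt_zero {H : Type*} [NormedAddCommGroup H]
    [InnerProductSpace ℝ H] {v : ℝ → H} (hv : ∀ t, 0 ≤ t → HasDerivWithinAt v 0 (Ici 0) t)
    {t : ℝ} (ht : 0 ≤ t) : v t = v 0 := by
  have h := le_initial_of_hasDerivWithinAt_nonpos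
    (fun t ht => ((hv t ht).sub_const (v 0)).norm_sq) (fun t _ => by simp) ht
  simp only [sub_self, norm_zero] at h
  rw [← sub_eq_zero, ← norm_eq_zero]
  exact pow_eq_zero_iff two_ne_zero |>.1 (le_antisymm (by simpa using h) (sq_nonneg _))

end Derivatives

variable {H : Type*} [NormedAddCommGroup H] [InnerProductSpace ℝ H]

section Parabolic

variable {A : H →ₗ.[ℝ] H} {p : ℝ} {b b' B c : ℝ → ℝ} {u₀ : H} {u : ℝ → H}

theorem IsParabolicSolution.graph (hu : IsParabolicSolution A p c u₀ u) {t : ℝ} (ht : 0 ≤ t) :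
    (u t, app A (u t)) ∈ A.graph :=
  mem_graph_app (hu.inDomain.1 t ht)

theorem IsParabolicSolution.D_eq_smul (hu : IsParabolicSolution A p c u₀ u)
    (hb : IsDissipation b b' B) (hbp : ∀ t, 0 ≤ t → b t = 1 / (1 + t) ^ p) {t : ℝ} (ht : 0 ≤ t) :
    D u t = -(c t / b t) • app A (u t) := by
  have h := hu.equation t ht
  rw [← hbp t ht, add_eq_zero_iff_eq_neg] at h
  have hbt := (hb.pos t ht).ne'
  calc D u t = (b t)⁻¹ • b t • D u t := by rw [inv_smul_smul₀ hbt]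
    _ = _ := by
      rw [h, smul_neg, smul_smul, neg_smul]
      congr 2
      field_simp

/-- The parabolic energy `⟨L u, K u⟩` of the regularized solution and its derivative. -/
theorem IsParabolicSolution.hasDerivWithinAt_form [CompleteSpace H]
    (hA : IsSelfAdjoint A) (hu : IsParabolicSolution A p c u₀ u)
    (hb : IsDissipation b b' B) (hbp : ∀ t, 0 ≤ t → b t = 1 / (1 + t) ^ p)
    {R K L : H →L[ℝ] H} (hR : IsRegularizer A R K L) {t : ℝ} (ht : 0 ≤ t) :
    HasDerivWithinAt (fun t => ⟪L (u t), K (u t)⟫) (-(2 * (c t / b t)) * ‖L (u t)‖ ^ 2)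
      (Ici 0) t := by
  have hd := hasDerivWithinAt_D hu.contDiff ht
  have hL := L.hasFDerivAt.comp_hasDerivWithinAt t hd
  have hK := K.hasFDerivAt.comp_hasDerivWithinAt t hd
  refine (hL.inner ℝ hK).congr_deriv ?_
  have h1 : K (D u t) = -(c t / b t) • L (u t) := by
    rw [hu.D_eq_smul hb hbp ht, map_smul, hR.comm' (hu.graph ht)]
  have h2 : ⟪L (D u t), K (u t)⟫ = ⟪K (D u t), L (u t)⟫ :=
    inner_graph_comm hA (hR.graph' _) (hR.graph' _)
  simp only [Function.comp_apply]
  rw [h2, h1, real_inner_smul_left, real_inner_smul_right, real_inner_self_eq_norm_sq]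
  ring

/-- Coerciveness applied at `K x`, whose image under A is `L x`. This makes ⟨L u, K u⟩ and |L u|² an
energy and its dissipation for the parabolic estimates. -/
theorem IsRegularizer.form_bounds {ν : ℝ} (hν : IsCoercive A ν) {R K L : H →L[ℝ] H}
    (hR : IsRegularizer A R K L) (x : H) :
    0 ≤ ⟪L x, K x⟫ ∧ ν * ⟪L x, K x⟫ ≤ ‖L x‖ ^ 2 := by
  have hν0 := hν.1
  refine ⟨le_trans (by positivity) (hν.le_inner (hR.graph' x)), ?_⟩
  calc ν * ⟪L x, K x⟫ ≤ ν * (‖L x‖ * ‖K x‖) := by gcongr; exact real_inner_le_norm _ _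
    _ = ‖L x‖ * (ν * ‖K x‖) := by ring
    _ ≤ ‖L x‖ * ‖L x‖ := by gcongr; exact hν.mul_norm_le (hR.graph' x)
    _ = _ := by ring

end Parabolic

/-- The corrector's derivative decays exponentially. -/
theorem IsCorrector.D_eq_exp_smul {p ε : ℝ} {b b' B : ℝ → ℝ} {θ₀ : H} {θ : ℝ → H}
    (hθ : IsCorrector p ε θ₀ θ) (hε : 0 < ε) (hb : IsDissipation b b' B)
    (hbp : ∀ t, 0 ≤ t → b t = 1 / (1 + t) ^ p) {t : ℝ} (ht : 0 ≤ t) :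
    D θ t = Real.exp (-B t / ε) • θ₀ := by
  have h : ∀ t, 0 ≤ t → HasDerivWithinAt (fun t => Real.exp (ε⁻¹ * B t) • D θ t) 0 (Ici 0) t := by
    intro t ht
    have h1 := (((hb.hasDeriv_primitive t ht).const_mul ε⁻¹).exp).smul
      (hasDerivWithinAt_D (contDiffOn_D hθ.contDiff) ht)
    refine h1.congr_deriv ?_
    have h2 := hθ.equation t ht
    rw [← hbp t ht] at h2
    rw [mul_smul, ← smul_add, mul_smul, smul_eq_zero]
    right
    have h3 : D (D θ) t = ε⁻¹ • ε • D (D θ) t := by rw [inv_smul_smul₀ hε.ne']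
    rw [h3, ← smul_add, h2, smul_zero]
  have h2 := eq_initial_of_hasDerivWithinAt_zero h ht
  simp only [hb.primitive_zero, mul_zero, Real.exp_zero, one_smul, hθ.initial_deriv] at h2
  rw [← h2, smul_smul, ← Real.exp_add]
  have : -B t / ε + ε⁻¹ * B t = 0 := by field_simp; ring
  rw [this, Real.exp_zero, one_smul]

variable [CompleteSpace H]

/-- The regularized difference of the hyperbolic and parabolic solutions satisfies the error
system. -/
theorem errorSystem_of_solutions {A S : H →ₗ.[ℝ] H} (hA : IsSelfAdjoint A) {ν : ℝ}
    (hν : IsCoercive A ν) (hS : IsSqrt A S) {R K L : H →L[ℝ] H} (hR : IsRegularizer A R K L)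
    {p : ℝ} {b b' B : ℝ → ℝ} (hb : IsDissipation b b' B)
    (hbp : ∀ t, 0 ≤ t → b t = 1 / (1 + t) ^ p)
    {μ M₁ M₂ M₃ M₄ M₅ : ℝ} (hμ : 0 < μ) {c : ℝ → ℝ} (hc : ContDiffOn ℝ 1 c (Ici 0))
    (hcl : ∀ t, 0 ≤ t → μ ≤ c t) (hcu : ∀ t, 0 ≤ t → c t ≤ M₁)
    (hcd : ∀ t, 0 ≤ t → |D c t| ≤ M₂) {ε : ℝ} (hε : 0 < ε) {k : ℝ → ℝ}
    (hk : ContDiffOn ℝ 1 k (Ici 0))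
    (hkl : ∀ t, 0 ≤ t → μ ≤ k t) (hku : ∀ t, 0 ≤ t → k t ≤ M₃)
    (hkd : ∀ t, 0 ≤ t → |D k t| ≤ M₄ / (1 + t) ^ p)
    (hkc : ∀ t, 0 ≤ t → |k t - c t| ≤ M₅ * ε)
    {u₀ u₁ : H} {u v θ ρ r : ℝ → H} (hu : IsParabolicSolution A p c u₀ u)
    (hv : IsHyperbolicSolution A p ε k u₀ u₁ v)
    (hθ : IsCorrector p ε (u₁ + c 0 • app A u₀) θ)
    (hρ : ∀ t, ρ t = v t - u t) (hr : ∀ t, r t = v t - u t - θ t)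
    {Θ P₀ : ℝ} (hΘ : ‖R (u₁ + c 0 • app A u₀)‖ ≤ Θ) {w : H}
    (hw : (R (u₁ + c 0 • app A u₀), w) ∈ S.graph) (hwΘ : ‖w‖ ≤ Θ)
    (hP₀ : ⟪L u₀, K u₀⟫ ≤ P₀) :
    ∃ (c' P' : ℝ → ℝ) (s' F : ℝ → H),
      ErrorSystem b B ν μ M₃ M₄ (((M₂ + M₁ + M₅) / ν + M₁ ^ 2) ^ 2) Θ P₀ ε k c'
        (fun t => ⟪K (ρ t), R (ρ t)⟫) (fun t => ⟪L (u t), K (u t)⟫) P' (fun t => ‖L (u t)‖ ^ 2)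
        (fun t => R (ρ t)) (fun t => R (D r t)) s' (fun t => R (D θ t)) F
        (fun t => K (ρ t)) := by
  have hν0 := hν.1
  have hvd : ∀ t, 0 ≤ t → HasDerivWithinAt v (D v t) (Ici 0) t := fun t ht =>
    hasDerivWithinAt_D (hv.contDiff.of_le (by norm_num)) ht
  have hud : ∀ t, 0 ≤ t → HasDerivWithinAt u (D u t) (Ici 0) t := fun t ht =>
    hasDerivWithinAt_D hu.contDiff ht
  have hθd : ∀ t, 0 ≤ t → HasDerivWithinAt θ (D θ t) (Ici 0) t := fun t ht =>
    hasDerivWithinAt_D (hθ.contDiff.of_le (by norm_num)) ht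
  have hρeq : ρ = fun t => v t - u t := funext hρ
  have hDr : ∀ t, 0 ≤ t → D r t = D v t - D u t - D θ t := fun t ht => by
    rw [show r = fun t => v t - u t - θ t from funext hr]
    exact D_eq ht (((hvd t ht).sub (hud t ht)).sub (hθd t ht))
  have hsum : ∀ t, 0 ≤ t → D r t + D θ t = D v t - D u t := fun t ht => by
    rw [hDr t ht]; abel
  have hρd : ∀ t, 0 ≤ t → HasDerivWithinAt ρ (D r t + D θ t) (Ici 0) t := fun t ht => by
    rw [hρeq, hsum t ht]
    exact (hvd t ht).sub (hud t ht)
  have hvg : ∀ t, 0 ≤ t → (v t, app A (v t)) ∈ A.graph := fun t ht =>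
    mem_graph_app (hv.inDomain.1 t ht)
  have hcb : ∀ t, 0 ≤ t → HasDerivWithinAt (fun t => c t / b t)
      ((D c t * b t - c t * b' t) / b t ^ 2) (Ici 0) t := fun t ht =>
    (hasDerivWithinAt_D hc ht).div (hb.hasDeriv t ht) (hb.pos t ht).ne'
  have hRDu : ∀ t, 0 ≤ t → R (D u t) = -(c t / b t) • K (u t) := fun t ht => by
    rw [hu.D_eq_smul hb hbp ht, map_smul, hR.comm _ _ (hu.graph ht)]
  have hKDu : ∀ t, 0 ≤ t → K (D u t) = -(c t / b t) • L (u t) := fun t ht => by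
    rw [hu.D_eq_smul hb hbp ht, map_smul, hR.comm' (hu.graph ht)]
  set f' : ℝ → ℝ := fun t => (D c t * b t - c t * b' t) / b t ^ 2 with hf'
  -- Since u is only C¹, u'' need not exist; R u' is differentiated through R u' = -(c/b) K u. Here
  -- f' is the derivative of c/b.
  have hRu : ∀ t, 0 ≤ t → HasDerivWithinAt (fun t => R (D u t))
      (-(f' t) • K (u t) + (c t / b t) ^ 2 • L (u t)) (Ici 0) t := fun t ht => by
    have h1 := (hcb t ht).neg.smul (K.hasFDerivAt.comp_hasDerivWithinAt t (hud t ht))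
    refine (h1.congr (fun x hx => ?_) ?_).congr_deriv ?_
    · exact hRDu x hx
    · exact hRDu t ht
    · simp only [Pi.neg_apply, Function.comp_apply]
      rw [hKDu t ht, smul_smul, add_comm]
      congr 2
      ring
  have hθ₀ : ∀ t, 0 ≤ t → R (D θ t) = Real.exp (-B t / ε) • R (u₁ + c 0 • app A u₀) :=
    fun t ht => by rw [hθ.D_eq_exp_smul hε hb hbp ht, map_smul]
  -- The source is the regularization of (c - k) A u - ε u'', with u'' replaced by -(c/b)' A u +
  -- (c/b)² A² u.
  refine ⟨D k, fun t => -(2 * (c t / b t)) * ‖L (u t)‖ ^ 2,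
    fun t => R (D (D v) t) - (-(f' t) • K (u t) + (c t / b t) ^ 2 • L (u t)) - R (D (D θ) t),
    fun t => (ε * f' t - (k t - c t)) • K (u t) - (ε * (c t / b t) ^ 2) • L (u t), ?_⟩
  refine
    { coeff_deriv := fun t ht => hasDerivWithinAt_D hk ht
      coeff_lower := hkl
      coeff_upper := hku
      coeff_deriv_le := fun t ht => ?_
      error_deriv := fun t ht => ?_
      velocity_deriv := fun t ht => ?_
      equation := fun t ht => ?_
      form_deriv := fun t ht => ?_
      form_eq := fun t ht => rfl
      form_coercive := fun t ht => hν.le_inner (hR.graph _)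
      corrector_le := fun t ht => ?_
      inner_corrector_le := fun t ht => ?_
      error_zero := ?_
      velocity_zero := ?_
      source_le := fun t ht => ?_
      parabolic_deriv := fun t ht => hu.hasDerivWithinAt_form hA hb hbp hR ht
      parabolic_nonneg := fun t ht => (hR.form_bounds hν _).1
      parabolic_coercive := fun t ht => (hR.form_bounds hν _).2
      dissipation_nonneg := fun t ht => sq_nonneg _
      parabolic_deriv_le := fun t ht => ?_
      parabolic_initial := by simpa only [hu.initial] using hP₀ }
  · rw [hbp t ht, mul_one_div]; exact hkd t ht
  · rw [← map_add]
    exact R.hasFDerivAt.comp_hasDerivWithinAt t (hρd t ht)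
  · have h1 := R.hasFDerivAt.comp_hasDerivWithinAt t
      (hasDerivWithinAt_D (contDiffOn_D hv.contDiff) ht)
    have h2 := R.hasFDerivAt.comp_hasDerivWithinAt t
      (hasDerivWithinAt_D (contDiffOn_D hθ.contDiff) ht)
    refine ((h1.sub (hRu t ht)).sub h2).congr (fun x hx => ?_) ?_
    · simp [hDr x hx]
    · simp [hDr t ht]
  · have hbt := (hb.pos t ht).ne'
    have e1 : ε • R (D (D v) t) = -(b t • R (D v t)) - k t • K (v t) := by
      have := congrArg R (hv.equation t ht)
      rw [← hbp t ht] at this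
      simp only [map_add, map_smul, map_zero] at this
      rw [hR.comm _ _ (hvg t ht), ← sub_eq_zero, ← this]
      abel
    have e2 : ε • R (D (D θ) t) = -(b t • R (D θ t)) := by
      have := congrArg R (hθ.equation t ht)
      rw [← hbp t ht] at this
      simp only [map_add, map_smul, map_zero] at this
      exact add_eq_zero_iff_eq_neg.1 this
    have e3 : b t • R (D u t) = -(c t • K (u t)) := by
      rw [hRDu t ht, smul_smul, ← neg_smul]
      congr 1
      field_simp
    rw [smul_sub, smul_sub, e1, e2, hDr t ht, hρ t]
    simp only [map_sub, smul_sub, e3]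
    module
  · have h1 := K.hasFDerivAt.comp_hasDerivWithinAt t (hρd t ht)
    have h2 := R.hasFDerivAt.comp_hasDerivWithinAt t (hρd t ht)
    refine (h1.inner ℝ h2).congr_deriv ?_
    have h3 : ⟪K (D r t + D θ t), R (ρ t)⟫ = ⟪R (D r t + D θ t), K (ρ t)⟫ :=
      inner_graph_comm hA (hR.graph _) (hR.graph _)
    simp only [Function.comp_apply]
    rw [h3, ← map_add, real_inner_comm (K (ρ t)) (R (D r t + D θ t))]
    ring
  · rw [hθ₀ t ht, norm_smul, Real.norm_of_nonneg (Real.exp_pos _).le, mul_comm]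
    gcongr
  -- Half of A is moved onto the corrector, ⟨Aρ, θ₀⟩ = ⟨A^{1/2}ρ, A^{1/2}θ₀⟩, so that only A^{1/2}θ₀
  -- has to be bounded.
  · obtain ⟨z, hz, hz'⟩ := (hS.2.2 _ _).1 (hR.graph (ρ t))
    have h1 : ⟪K (ρ t), R (u₁ + c 0 • app A u₀)⟫ = ⟪z, w⟫ := inner_graph_comm hS.1 hz' hw
    have h2 : ⟪K (ρ t), R (ρ t)⟫ = ‖z‖ ^ 2 := by
      rw [← real_inner_self_eq_norm_sq]; exact inner_graph_comm hS.1 hz' hz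
    rw [h2, Real.sqrt_sq (norm_nonneg _), hθ₀ t ht, real_inner_smul_right, h1, abs_mul,
      abs_of_pos (Real.exp_pos _), mul_comm, ← mul_assoc]
    gcongr
    exact (abs_real_inner_le_norm z w).trans (by gcongr)
  · simp [hρ, hv.initial, hu.initial]
  -- The parabolic equation gives u'(0) = -c(0) A u₀ because b(0) = 1; the initial velocity of the
  -- corrector is exactly the resulting mismatch.
  · have h1 : D u 0 = -c 0 • app A u₀ := by
      rw [hu.D_eq_smul hb hbp le_rfl, hu.initial, hbp 0 le_rfl]
      simp
    simp only [hDr 0 le_rfl, hv.initial_deriv, hθ.initial_deriv, h1]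
    rw [show u₁ - -c 0 • app A u₀ - (u₁ + c 0 • app A u₀) = 0 by rw [neg_smul]; abel, map_zero]
  · have hbt := hb.pos t ht
    have hc0 : 0 ≤ c t := hμ.le.trans (hcl t ht)
    have hM₁ : 0 ≤ M₁ := hc0.trans (hcu t ht)
    have hM₂ : 0 ≤ M₂ := (abs_nonneg _).trans (hcd t ht)
    have hM₅ : 0 ≤ M₅ := by
      have := (abs_nonneg _).trans (hkc t ht)
      exact nonneg_of_mul_nonneg_left this hε
    have hKL : ‖K (u t)‖ ≤ ‖L (u t)‖ / ν := by
      rw [le_div_iff₀ hν0, mul_comm]; exact hν.mul_norm_le (hR.graph' _)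
    -- Both (c/b)' and (c/b)² have denominator b², whence the weight b⁴ in the bound on |F|².
    have hf : b t ^ 2 * |f' t| ≤ M₂ + M₁ := by
      have : b t ^ 2 * |f' t| = |D c t * b t - c t * b' t| := by
        rw [hf', abs_div, abs_of_pos (pow_pos hbt 2)]
        field_simp
      rw [this]
      refine (abs_sub _ _).trans ?_
      rw [abs_mul, abs_mul, abs_of_pos hbt, abs_of_nonneg hc0]
      have hb1 := hb.le_one t ht
      have hb2 : |b' t| ≤ 1 := by
        rw [abs_le]
        have := hb.deriv_nonpos t ht
        have := hb.neg_le_deriv t ht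
        constructor <;> linarith
      have h1 : |D c t| * b t ≤ M₂ * 1 := by gcongr; exact hcd t ht
      have h2 : c t * |b' t| ≤ M₁ * 1 := by gcongr; exact hcu t ht
      linarith
    have hF : b t ^ 2 * ‖(ε * f' t - (k t - c t)) • K (u t) - (ε * (c t / b t) ^ 2) • L (u t)‖ ≤
        ε * ((M₂ + M₁ + M₅) / ν + M₁ ^ 2) * ‖L (u t)‖ := by
      have h1 : b t ^ 2 * |ε * f' t - (k t - c t)| ≤ ε * (M₂ + M₁ + M₅) := by
        have h2 : |ε * f' t - (k t - c t)| ≤ ε * |f' t| + M₅ * ε := by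
          refine (abs_sub _ _).trans ?_
          rw [abs_mul, abs_of_pos hε]
          linarith [hkc t ht]
        have h3 : b t ^ 2 * (M₅ * ε) ≤ 1 * (M₅ * ε) := by
          gcongr
          exact pow_le_one₀ hbt.le (hb.le_one t ht)
        calc _ ≤ b t ^ 2 * (ε * |f' t| + M₅ * ε) := by gcongr
          _ = ε * (b t ^ 2 * |f' t|) + b t ^ 2 * (M₅ * ε) := by ring
          _ ≤ ε * (M₂ + M₁) + 1 * (M₅ * ε) := by gcongr
          _ = _ := by ring
      have h4 : b t ^ 2 * (ε * (c t / b t) ^ 2) ≤ ε * M₁ ^ 2 := by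
        have : b t ^ 2 * (ε * (c t / b t) ^ 2) = ε * c t ^ 2 := by field_simp
        rw [this]
        gcongr
        exact hcu t ht
      have h5 := norm_sub_le ((ε * f' t - (k t - c t)) • K (u t))
        ((ε * (c t / b t) ^ 2) • L (u t))
      rw [norm_smul, norm_smul, Real.norm_eq_abs, Real.norm_of_nonneg (by positivity)] at h5
      calc _ ≤ b t ^ 2 * (|ε * f' t - (k t - c t)| * ‖K (u t)‖
            + ε * (c t / b t) ^ 2 * ‖L (u t)‖) := by gcongr
        _ = b t ^ 2 * |ε * f' t - (k t - c t)| * ‖K (u t)‖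
            + b t ^ 2 * (ε * (c t / b t) ^ 2) * ‖L (u t)‖ := by ring
        _ ≤ ε * (M₂ + M₁ + M₅) * (‖L (u t)‖ / ν) + ε * M₁ ^ 2 * ‖L (u t)‖ := by gcongr
        _ = _ := by ring
    have := pow_le_pow_left₀ (by positivity) hF 2
    calc _ = (b t ^ 2 * ‖(ε * f' t - (k t - c t)) • K (u t)
          - (ε * (c t / b t) ^ 2) • L (u t)‖) ^ 2 := by ring
      _ ≤ _ := this
      _ = _ := by ring
  · have hbt := hb.pos t ht
    have h1 : 2 * μ / b t ≤ 2 * (c t / b t) := by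
      rw [← mul_div_assoc]
      gcongr
      exact hcl t ht
    have := mul_le_mul_of_nonneg_right h1 (sq_nonneg ‖L (u t)‖)
    simp only [neg_mul]
    linarith

end

/-! ### The coefficient (1+t)^{-p} and its decay rates -/

section

/-- A primitive of `(1 + t)^{-p}`. -/
noncomputable def dissipationPrimitive (p t : ℝ) : ℝ :=
  if p = 1 then Real.log (1 + t) else ((1 + t) ^ (1 - p) - 1) / (1 - p)

theorem isDissipation_rpow {p : ℝ} (hp0 : 0 ≤ p) (hp1 : p ≤ 1) :
    IsDissipation (fun t => (1 + t) ^ (-p)) (fun t => -p * (1 + t) ^ (-p - 1))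
      (dissipationPrimitive p) where
  hasDeriv t ht := by
    have h : HasDerivAt (fun t : ℝ => 1 + t) 1 t := (hasDerivAt_id t).const_add 1
    have := h.rpow_const (p := -p) (Or.inl (by linarith : (1 : ℝ) + t ≠ 0))
    exact (this.congr_deriv (by ring)).hasDerivWithinAt
  hasDeriv_primitive t ht := by
    have h : HasDerivAt (fun t : ℝ => 1 + t) 1 t := (hasDerivAt_id t).const_add 1
    have h0 : (1 : ℝ) + t ≠ 0 := by positivity
    by_cases hp : p = 1
    · subst hp
      have he : dissipationPrimitive 1 = fun t => Real.log (1 + t) := by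
        funext t; simp [dissipationPrimitive]
      rw [he]
      refine ((h.log h0).congr_deriv ?_).hasDerivWithinAt
      rw [Real.rpow_neg_one, one_div]
    · have he : dissipationPrimitive p = fun t => ((1 + t) ^ (1 - p) - 1) / (1 - p) := by
        funext t; simp [dissipationPrimitive, hp]
      have hp' : 1 - p ≠ 0 := sub_ne_zero.2 (Ne.symm hp)
      rw [he]
      refine ((((h.rpow_const (p := 1 - p) (Or.inl h0)).sub_const 1).div_const
        (1 - p)).congr_deriv ?_).hasDerivWithinAt
      rw [show 1 - p - 1 = -p by ring]
      field_simp
  pos t ht := by positivity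
  le_one t ht := Real.rpow_le_one_of_one_le_of_nonpos (by linarith) (by linarith)
  deriv_nonpos t ht := by
    have : 0 ≤ p * (1 + t) ^ (-p - 1) := by positivity
    linarith
  neg_le_deriv t ht := by
    have h1 : (1 + t) ^ (-p - 1) ≤ (1 + t) ^ (-p) :=
      Real.rpow_le_rpow_of_exponent_le (by linarith) (by linarith)
    have h2 : 0 ≤ (1 + t) ^ (-p - 1) := by positivity
    nlinarith
  primitive_zero := by simp [dissipationPrimitive]
  exp_le t ht := by
    have h0 : (0 : ℝ) < 1 + t := by positivity
    -- For p < 1 this is log x ≤ x - 1 at x = (1+t)^{1-p}.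
    have hlog : Real.log (1 + t) ≤ dissipationPrimitive p t := by
      unfold dissipationPrimitive
      split_ifs with hp
      · exact le_rfl
      · have hp' : 0 < 1 - p := sub_pos.2 (lt_of_le_of_ne hp1 hp)
        rw [le_div_iff₀ hp', mul_comm, ← Real.log_rpow h0]
        exact Real.log_le_sub_one_of_pos (by positivity)
    calc Real.exp (-dissipationPrimitive p t) ≤ Real.exp (-Real.log (1 + t)) := by gcongr
      _ = (1 + t) ^ (-1 : ℝ) := by rw [Real.exp_neg, Real.exp_log h0, Real.rpow_neg_one]
      _ ≤ (1 + t) ^ (-p) := Real.rpow_le_rpow_of_exponent_le (by linarith) (by linarith)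

/-- The decay rates of the theorem: below `m` if `p = 0`, arbitrary otherwise. -/
def IsDecayRate (p m β : ℝ) : Prop := 0 ≤ β ∧ (p = 0 → β < m)

/-- For p = 0 half of the gap m - β is kept as margin. For p > 0 the product β b tends to 0, so η =
1/2 works after some time T; before T the factor e^{T-t} ≥ 1 lets the integrable term cover the
whole left side. -/
theorem IsDecayRate.isAdmissibleRate {p m β : ℝ} (hp0 : 0 ≤ p) (hm : 0 < m)
    (hβ : IsDecayRate p m β) : IsAdmissibleRate (fun t => (1 + t) ^ (-p)) m β := by
  obtain ⟨hβ0, hβ⟩ := hβ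
  rcases hp0.eq_or_lt with rfl | hp
  · have := hβ rfl
    refine ⟨(m - β) / (2 * m), 0, div_pos (by linarith) (by linarith), ?_, le_rfl, fun t _ => ?_⟩
    · rw [div_lt_one (by linarith)]; linarith
    · have h : m * (1 - (m - β) / (2 * m)) = (m + β) / 2 := by field_simp; ring
      simp [h]; linarith
  · have h1 : Tendsto (fun t : ℝ => β * (1 + t) ^ (-p)) atTop (𝓝 0) := by
      have := ((tendsto_rpow_neg_atTop hp).comp (tendsto_atTop_add_const_left atTop (1 : ℝ)
        tendsto_id)).const_mul β
      simpa using this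
    obtain ⟨T, hT⟩ := eventually_atTop.1 (h1.eventually_lt_const (half_pos hm))
    refine ⟨1 / 2, β * Real.exp T, by norm_num, by norm_num, by positivity, fun t ht => ?_⟩
    have hb0 : (0 : ℝ) < (1 + t) ^ (-p) := by positivity
    have hb1 : (1 + t) ^ (-p) ≤ 1 :=
      Real.rpow_le_one_of_one_le_of_nonpos (by linarith) (by linarith)
    have h2 : β * ((1 + t) ^ (-p)) ^ 2 ≤ β * (1 + t) ^ (-p) := by
      gcongr; nlinarith
    rcases le_total T t with h | h
    · have := hT t h
      have : 0 ≤ β * Real.exp T * ((1 + t) ^ (-p) * Real.exp (-t)) := by positivity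
      linarith
    · have h3 : β * (1 + t) ^ (-p) * 1 ≤ β * (1 + t) ^ (-p) * (Real.exp T * Real.exp (-t)) := by
        gcongr
        rw [← Real.exp_add]
        exact Real.one_le_exp (by linarith)
      linarith

/-- Powers of `b` can be absorbed by a change of the decay rate. -/
theorem IsDecayRate.exists_absorb {p m β : ℝ} (hp0 : 0 ≤ p) (hp1 : p ≤ 1)
    (hβ : IsDecayRate p m β) (n : ℕ) :
    ∃ κ, IsDecayRate p m κ ∧ ∀ t, 0 ≤ t → Real.exp (β * dissipationPrimitive p t) ≤
      ((1 + t) ^ (-p)) ^ n * Real.exp (κ * dissipationPrimitive p t) := by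
  -- For p = 0 the rate is capped, but b = 1 and nothing has to be absorbed. For p > 0 each factor b
  -- costs one unit of rate, since e^{-B} ≤ b.
  rcases hp0.eq_or_lt with rfl | hp
  · exact ⟨β, hβ, fun t _ => by simp⟩
  · refine ⟨β + n, ⟨by linarith [hβ.1, n.cast_nonneg (α := ℝ)], fun h => absurd h hp.ne'⟩,
      fun t ht => ?_⟩
    have h1 := (isDissipation_rpow hp0 hp1).exp_le t ht
    calc Real.exp (β * dissipationPrimitive p t) = Real.exp (-dissipationPrimitive p t) ^ n *
          Real.exp ((β + n) * dissipationPrimitive p t) := by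
          rw [← Real.exp_nat_mul, ← Real.exp_add]; congr 1; ring
      _ ≤ _ := by gcongr

theorem ErrorBound.mono {ε₀ K : ℝ} {Γ : ℝ → ℝ → ℝ} {φ ψ : ℝ → ℝ} (h : ErrorBound ε₀ Γ φ)
    (hφ : ∀ t, 0 ≤ t → 0 ≤ φ t) (hφψ : ∀ t, 0 ≤ t → φ t ≤ K * ψ t) : ErrorBound ε₀ Γ ψ := by
  obtain ⟨ε₁, h1, h2, C, hC⟩ := h
  refine ⟨ε₁, h1, h2, |C| * K, fun ε hε hε1 t ht => (hC ε hε hε1 t ht).trans ?_⟩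
  calc C * ε ^ 2 * φ t ≤ |C| * ε ^ 2 * φ t := by
        have := hφ t ht
        gcongr
        exact le_abs_self C
    _ ≤ |C| * ε ^ 2 * (K * ψ t) := by gcongr; exact hφψ t ht
    _ = _ := by ring

/-- The three cases of the decay-error estimates are instances of one. -/
theorem decayErrorEstimates_of_forall {p μ ν ε₀ : ℝ} (hμ : 0 < μ) (hν : 0 < ν)
    {Γ : ℝ → ℝ → ℝ}
    (h : ∀ β, IsDecayRate p (2 * μ * ν) β →
      ErrorBound ε₀ Γ (fun t => Real.exp (-β * dissipationPrimitive p t))) :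
    DecayErrorEstimates p μ ν ε₀ Γ := by
  refine ⟨fun hp β hβ => ?_, fun hp hp1 β hβ => ?_, fun hp β hβ => ?_⟩
  · subst hp
    -- Decay rates are nonnegative by definition, whereas here β may be negative.
    refine (h (max β 0) ⟨le_max_right _ _, fun _ => max_lt hβ (by positivity)⟩).mono (K := 1)
      (fun t _ => (Real.exp_pos _).le) fun t ht => ?_
    have h1 : dissipationPrimitive 0 t = t := by simp [dissipationPrimitive]
    rw [h1, one_mul]
    have := mul_le_mul_of_nonneg_right (le_max_left β 0) ht
    gcongr
    exact le_max_left _ _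
  · have hp' : 0 < 1 - p := sub_pos.2 hp1
    -- Since (1-p) B = (1+t)^{1-p} - 1, the rate is rescaled by 1 - p, and the -1 costs the factor
    -- e^β.
    refine (h (β * (1 - p)) ⟨by positivity, fun h => absurd h hp.ne'⟩).mono (K := Real.exp β)
      (fun t _ => (Real.exp_pos _).le) fun t ht => ?_
    rw [dissipationPrimitive, if_neg hp1.ne, ← Real.exp_add]
    apply le_of_eq
    congr 1
    field_simp
    ring
  · subst hp
    refine (h β ⟨hβ.le, fun h => absurd h one_ne_zero⟩).mono (K := 1)
      (fun t _ => (Real.exp_pos _).le) fun t ht => ?_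
    have h0 : (0 : ℝ) < 1 + t := by positivity
    rw [dissipationPrimitive, if_pos rfl, one_mul, one_div, ← Real.rpow_neg h0.le,
      Real.rpow_def_of_pos h0, mul_comm]

end

/-! ### Domain propagation and the reduced estimate -/

section

variable {H : Type*} [NormedAddCommGroup H] [InnerProductSpace ℝ H]

theorem IsResolvent.norm_pow_three_le {A : H →ₗ.[ℝ] H} {l : ℝ} {J K : H →L[ℝ] H}
    (h : IsResolvent A l J K) (x : H) : ‖J (J (J x))‖ ≤ ‖x‖ :=
  ((h.norm_le _).trans (h.norm_le _)).trans (h.norm_le _)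

theorem app_eq_of_mem_graph {T : H →ₗ.[ℝ] H} {x y : H} (h : (x, y) ∈ T.graph) : app T x = y :=
  (mem_graph_iff_app.1 h).2

theorem mem_domain_of_mem_graph {T : H →ₗ.[ℝ] H} {x y : H} (h : (x, y) ∈ T.graph) :
    x ∈ T.domain :=
  (mem_graph_iff_app.1 h).1

theorem rpow_neg_eq {p t : ℝ} (ht : 0 ≤ t) : (1 + t) ^ (-p) = 1 / (1 + t) ^ p := by
  rw [Real.rpow_neg (by linarith), one_div]

variable [CompleteSpace H]

/-- The data of the singular perturbation problem. -/
structure PerturbationData (A : H →ₗ.[ℝ] H) (ν p ε₀ μ M₁ M₂ M₃ M₄ M₅ : ℝ) (c : ℝ → ℝ)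
    (cε : ℝ → ℝ → ℝ) (u₀ u₁ : H) (u : ℝ → H) (uε θ ρ r : ℝ → ℝ → H) : Prop where
  selfAdjoint : IsSelfAdjoint A
  coercive : IsCoercive A ν
  p_nonneg : 0 ≤ p
  p_le_one : p ≤ 1
  μ_pos : 0 < μ
  contDiff : ContDiffOn ℝ 1 c (Ici 0)
  lower : ∀ t, 0 ≤ t → μ ≤ c t
  upper : ∀ t, 0 ≤ t → c t ≤ M₁
  deriv_le : ∀ t, 0 ≤ t → |D c t| ≤ M₂
  contDiff' : ∀ ε, 0 < ε → ε < ε₀ → ContDiffOn ℝ 1 (cε ε) (Ici 0)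
  lower' : ∀ ε, 0 < ε → ε < ε₀ → ∀ t, 0 ≤ t → μ ≤ cε ε t
  upper' : ∀ ε, 0 < ε → ε < ε₀ → ∀ t, 0 ≤ t → cε ε t ≤ M₃
  deriv_le' : ∀ ε, 0 < ε → ε < ε₀ → ∀ t, 0 ≤ t → |D (cε ε) t| ≤ M₄ / (1 + t) ^ p
  dist_le : ∀ ε, 0 < ε → ε < ε₀ → ∀ t, 0 ≤ t → |cε ε t - c t| ≤ M₅ * ε
  parabolic : IsParabolicSolution A p c u₀ u
  hyperbolic : ∀ ε, 0 < ε → ε < ε₀ → IsHyperbolicSolution A p ε (cε ε) u₀ u₁ (uε ε)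
  corrector : ∀ ε, 0 < ε → ε < ε₀ → IsCorrector p ε (u₁ + c 0 • app A u₀) (θ ε)
  error_eq : ∀ ε t, ρ ε t = uε ε t - u t
  remainder_eq : ∀ ε t, r ε t = uε ε t - u t - θ ε t

theorem exists_resolvent_seq {A : H →ₗ.[ℝ] H} (hA : IsSelfAdjoint A) {ν : ℝ}
    (hν : IsCoercive A ν) :
    ∃ (l : ℕ → ℝ) (J K : ℕ → H →L[ℝ] H), (∀ n, 0 < l n) ∧
      (∀ n, IsResolvent A (l n) (J n) (K n)) ∧
      ∀ x, Tendsto (fun n => J n (J n (J n x))) atTop (𝓝 x) := by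
  have hl : ∀ n : ℕ, (0 : ℝ) < 1 / ((n : ℝ) + 1) := fun n => by positivity
  choose J K hJ using fun n => exists_isResolvent hA hν (hl n)
  exact ⟨_, J, K, hl, hJ, tendsto_resolvent_pow_three (fun n => (hJ n).norm_le)
    (tendsto_resolvent hA hν hl tendsto_one_div_add_atTop_nhds_zero_nat hJ)⟩

theorem sqrt_form_eq {A S : H →ₗ.[ℝ] H} (hS : IsSqrt A S) {x q y : H}
    (hq : (x, q) ∈ S.graph) (hy : (x, y) ∈ A.graph) : ⟪y, x⟫ = ‖q‖ ^ 2 := by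
  obtain ⟨z, hz, hz'⟩ := (hS.2.2 _ _).1 hy
  rw [graph_unique hq hz, ← real_inner_self_eq_norm_sq]
  exact inner_graph_comm hS.1 hz' hz

/-- The domain of the square root is preserved along the derivative of a `C¹` curve. -/
theorem D_mem_domain {S : H →ₗ.[ℝ] H} (hS : IsSelfAdjoint S) {v : ℝ → H}
    (hv : IsCkInDomain 1 S v) {t : ℝ} (ht : 0 ≤ t) : D v t ∈ S.domain := by
  obtain ⟨h1, h2, h3⟩ := hv
  rw [Nat.cast_one] at h2 h3
  refine mem_domain_of_mem_graph (y := D (fun t => app S (v t)) t)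
    (mem_graph_of_inner hS fun x' y' h => ?_)
  -- Both sides of ⟨S v, x'⟩ = ⟨v, S x'⟩ are differentiated; maximality of S then identifies S v'
  -- with (S v)'.
  have e1 := (hasDerivWithinAt_D h3 ht).inner ℝ (hasDerivWithinAt_const t (Ici 0) x')
  have e2 := (hasDerivWithinAt_D h2 ht).inner ℝ (hasDerivWithinAt_const t (Ici 0) y')
  have e3 := e2.congr (fun x hx => inner_graph_comm hS (mem_graph_app (h1 x hx)) h)
    (inner_graph_comm hS (mem_graph_app (h1 t ht)) h)
  simpa using (uniqueDiffOn_Ici 0 t ht).eq_deriv _ e1 e3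

section Data

variable {A : H →ₗ.[ℝ] H} {ν p ε₀ μ M₁ M₂ M₃ M₄ M₅ : ℝ} {c : ℝ → ℝ}
    {cε : ℝ → ℝ → ℝ} {u₀ u₁ : H} {u : ℝ → H} {uε θ ρ r : ℝ → ℝ → H}

/-- `A u(t)` stays in the domain of the square root. -/
theorem PerturbationData.app_mem_domain_sqrt
    (d : PerturbationData A ν p ε₀ μ M₁ M₂ M₃ M₄ M₅ c cε u₀ u₁ u uε θ ρ r)
    {S : H →ₗ.[ℝ] H} (hS : IsSqrt A S) (h₀ : u₀ ∈ A.domain) {z₀ : H}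
    (hz₀ : (app A u₀, z₀) ∈ S.graph) {t : ℝ} (ht : 0 ≤ t) : app A (u t) ∈ S.domain := by
  have hA := d.selfAdjoint
  have hν := d.coercive
  have hb := isDissipation_rpow d.p_nonneg d.p_le_one
  obtain ⟨l, J, K, hl, hJ, hlim⟩ := exists_resolvent_seq hA hν
  refine mem_domain_of_abs_inner_le hS.1 ‖z₀‖ fun x' y' h => ?_
  have hlim' : Tendsto (fun n => |⟪J n (J n (J n (app A (u t)))), y'⟫|) atTop
      (𝓝 |⟪app A (u t), y'⟫|) :=
    ((hlim (app A (u t))).inner tendsto_const_nhds).abs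
  refine le_of_tendsto' hlim' fun n => ?_
  have hR := (hJ n).isRegularizer hν (hl n) (V := J n)
    (fun x y hxy => (hJ n).map_graph hν (hl n) hxy)
  obtain ⟨q, hq, -⟩ := (hS.2.2 _ _).1 (hR.graph (app A (u t)))
  have hg := d.parabolic.graph ht
  have hform : ∀ x y q, (x, y) ∈ A.graph → (J n (J n (J n y)), q) ∈ S.graph →
      ⟪(K n ∘L K n ∘L J n) x, (K n ∘L J n ∘L J n) x⟫ = ‖q‖ ^ 2 := by
    intro x y q hxy hq
    rw [hR.comm' hxy, hR.comm _ _ hxy]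
    exact sqrt_form_eq hS hq (hR.graph y)
  -- The regularized parabolic energy equals |S J³ A u|² and does not increase, so it stays below
  -- |J³ z₀|² ≤ |z₀|², uniformly in the resolvent.
  have hmono := le_initial_of_hasDerivWithinAt_nonpos
    (fun t ht => d.parabolic.hasDerivWithinAt_form hA hb (fun t ht => rpow_neg_eq ht) hR ht)
    (fun t ht => by
      have h1 := d.μ_pos.trans_le (d.lower t ht)
      have h2 : (0 : ℝ) < (1 + t) ^ (-p) := by positivity
      rw [neg_mul, neg_nonpos]
      positivity) ht
  simp only [d.parabolic.initial] at hmono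
  rw [hform _ _ q hg hq, hform _ _ _ (mem_graph_app h₀)
    ((hJ n).map_sqrt hν (hl n) hS ((hJ n).map_sqrt hν (hl n) hS
      ((hJ n).map_sqrt hν (hl n) hS hz₀)))] at hmono
  have hqz : ‖q‖ ≤ ‖z₀‖ :=
    (abs_le_of_sq_le_sq' hmono (norm_nonneg _)).2.trans ((hJ n).norm_pow_three_le z₀)
  have : ⟪J n (J n (J n (app A (u t)))), y'⟫ = ⟪q, x'⟫ := (inner_graph_comm hS.1 hq h).symm
  rw [this]
  exact (abs_real_inner_le_norm _ _).trans (by gcongr)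

theorem PerturbationData.D_remainder
    (d : PerturbationData A ν p ε₀ μ M₁ M₂ M₃ M₄ M₅ c cε u₀ u₁ u uε θ ρ r)
    {ε : ℝ} (hε : 0 < ε) (hε₀ : ε < ε₀) {t : ℝ} (ht : 0 ≤ t) :
    D (r ε) t = D (uε ε) t - D u t - D (θ ε) t := by
  rw [show r ε = fun t => uε ε t - u t - θ ε t from funext (d.remainder_eq ε)]
  exact D_eq ht (((hasDerivWithinAt_D ((d.hyperbolic ε hε hε₀).contDiff.of_le (by norm_num))
    ht).sub (hasDerivWithinAt_D d.parabolic.contDiff ht)).sub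
      (hasDerivWithinAt_D ((d.corrector ε hε hε₀).contDiff.of_le (by norm_num)) ht))

/-- Each of the three terms of r' lies in the domain: u_ε' by its regularity class, u' because it is
a multiple of A u, and θ' because it is a multiple of θ₀. -/
theorem PerturbationData.D_remainder_mem
    (d : PerturbationData A ν p ε₀ μ M₁ M₂ M₃ M₄ M₅ c cε u₀ u₁ u uε θ ρ r)
    (hS : IsSqrt A (sqrtOp A)) (h₀ : MemDomThreeHalves A u₀) (h₁ : MemDomHalf A u₁)
    {ε : ℝ} (hε : 0 < ε) (hε₀ : ε < ε₀) {t : ℝ} (ht : 0 ≤ t) :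
    D (r ε) t ∈ (sqrtOp A).domain := by
  have hb := isDissipation_rpow d.p_nonneg d.p_le_one
  rw [d.D_remainder hε hε₀ ht]
  refine sub_mem (sub_mem (D_mem_domain hS.1 (d.hyperbolic ε hε hε₀).inDomainHalf ht) ?_) ?_
  · rw [d.parabolic.D_eq_smul hb (fun t ht => rpow_neg_eq ht) ht]
    exact Submodule.smul_mem _ _ (d.app_mem_domain_sqrt hS h₀.1 (mem_graph_app h₀.2) ht)
  · rw [(d.corrector ε hε hε₀).D_eq_exp_smul hε hb (fun t ht => rpow_neg_eq ht) ht]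
    exact Submodule.smul_mem _ _ (add_mem h₁ (Submodule.smul_mem _ _ h₀.2))

theorem PerturbationData.error_mem_domain
    (d : PerturbationData A ν p ε₀ μ M₁ M₂ M₃ M₄ M₅ c cε u₀ u₁ u uε θ ρ r)
    {ε : ℝ} (hε : 0 < ε) (hε₀ : ε < ε₀) {t : ℝ} (ht : 0 ≤ t) : ρ ε t ∈ A.domain := by
  rw [d.error_eq]
  exact sub_mem ((d.hyperbolic ε hε hε₀).inDomain.1 t ht) (d.parabolic.inDomain.1 t ht)

theorem domain_le_domain_sqrt {S : H →ₗ.[ℝ] H} (hS : IsSqrt A S) {x : H} (hx : x ∈ A.domain) :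
    x ∈ S.domain := by
  obtain ⟨z, hz, -⟩ := (hS.2.2 _ _).1 (mem_graph_app hx)
  exact mem_domain_of_mem_graph hz

/-- The regularized error system and its decay, uniformly in the regularizer. -/
theorem PerturbationData.regularized_decay
    (d : PerturbationData A ν p ε₀ μ M₁ M₂ M₃ M₄ M₅ c cε u₀ u₁ u uε θ ρ r) (hε₀ : 0 < ε₀)
    {S : H →ₗ.[ℝ] H} (hS : IsSqrt A S) {Θ P₀ β κ : ℝ} (hΘ0 : 0 ≤ Θ)
    (hβ : IsDecayRate p (2 * μ * ν) β) (hκ : IsDecayRate p (2 * μ * ν) κ)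
    (hβκ : ∀ t, 0 ≤ t → Real.exp (β * dissipationPrimitive p t) ≤
      ((1 + t) ^ (-p)) ^ 4 * Real.exp (κ * dissipationPrimitive p t)) :
    ∃ ε₁ C : ℝ, 0 < ε₁ ∧ ∀ R K L : H →L[ℝ] H, IsRegularizer A R K L →
      ‖R (u₁ + c 0 • app A u₀)‖ ≤ Θ → ∀ w, (R (u₁ + c 0 • app A u₀), w) ∈ S.graph → ‖w‖ ≤ Θ →
      ⟪L u₀, K u₀⟫ ≤ P₀ → ∀ ε, 0 < ε → ε < ε₀ →
      ∃ (c' P' : ℝ → ℝ) (s' F : ℝ → H),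
        ErrorSystem (fun t => (1 + t) ^ (-p)) (dissipationPrimitive p) ν μ M₃ M₄
          (((M₂ + M₁ + M₅) / ν + M₁ ^ 2) ^ 2) Θ P₀ ε (cε ε) c'
          (fun t => ⟪K (ρ ε t), R (ρ ε t)⟫) (fun t => ⟪L (u t), K (u t)⟫) P'
          (fun t => ‖L (u t)‖ ^ 2) (fun t => R (ρ ε t)) (fun t => R (D (r ε) t)) s'
          (fun t => R (D (θ ε) t)) F (fun t => K (ρ ε t)) ∧
        (ε < ε₁ → ∀ t, 0 ≤ t → ‖R (ρ ε t)‖ ^ 2 + ⟪K (ρ ε t), R (ρ ε t)⟫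
          + ε * ‖R (D (r ε) t)‖ ^ 2 ≤ C * ε ^ 2 * Real.exp (-β * dissipationPrimitive p t)) := by
  have hμ := d.μ_pos
  have hν := d.coercive.1
  have hb := isDissipation_rpow d.p_nonneg d.p_le_one
  have hm : 0 < 2 * μ * ν := by positivity
  -- One admissible value of ε at t = 0 suffices to see that M₃ and M₄ are nonnegative.
  have h2 : 0 < ε₀ / 2 := half_pos hε₀
  have h3 : ε₀ / 2 < ε₀ := half_lt_self hε₀
  have hM₃ : 0 ≤ M₃ := hμ.le.trans ((d.lower' _ h2 h3 0 le_rfl).trans (d.upper' _ h2 h3 0 le_rfl))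
  have hM₄ : 0 ≤ M₄ := by
    simpa using (abs_nonneg _).trans (d.deriv_le' _ h2 h3 0 le_rfl)
  obtain ⟨ε₁, C, hε₁, h⟩ := (hβ.isAdmissibleRate d.p_nonneg hm).error_decay (H := H) (P₀ := P₀)
    (CF := ((M₂ + M₁ + M₅) / ν + M₁ ^ 2) ^ 2) (M₃ := M₃) (M₄ := M₄) hb hμ hν
    hM₃ hM₄ hβ.1 (hκ.isAdmissibleRate d.p_nonneg hm) hβκ (sq_nonneg _) hΘ0
  refine ⟨ε₁, C, hε₁, fun R K L hR hΘ w hw hwΘ hP₀ ε hε hεε₀ => ?_⟩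
  obtain ⟨c', P', s', F, hsys⟩ := errorSystem_of_solutions d.selfAdjoint d.coercive hS hR hb
    (fun t ht => rpow_neg_eq ht) hμ d.contDiff d.lower d.upper d.deriv_le hε
    (d.contDiff' ε hε hεε₀) (d.lower' ε hε hεε₀) (d.upper' ε hε hεε₀) (d.deriv_le' ε hε hεε₀)
    (d.dist_le ε hε hεε₀) d.parabolic (d.hyperbolic ε hε hεε₀) (d.corrector ε hε hεε₀)
    (d.error_eq ε) (d.remainder_eq ε) hΘ hw hwΘ hP₀
  exact ⟨c', P', s', F, hsys, fun hlt => h ε _ _ _ _ _ _ _ _ _ _ _ _ hε hlt hsys⟩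

/-- The reduced estimate, for data in `D(A^{3/2}) × D(A^{1/2})`. -/
theorem PerturbationData.reduced_bound
    (d : PerturbationData A ν p ε₀ μ M₁ M₂ M₃ M₄ M₅ c cε u₀ u₁ u uε θ ρ r) (hε₀ : 0 < ε₀)
    (hS : IsSqrt A (sqrtOp A)) (h₀ : MemDomThreeHalves A u₀) (h₁ : MemDomHalf A u₁)
    {β : ℝ} (hβ : IsDecayRate p (2 * μ * ν) β) :
    ErrorBound ε₀ (fun ε => gammaReduced A ε (ρ ε) (r ε))
      (fun t => Real.exp (-β * dissipationPrimitive p t)) := by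
  have hA := d.selfAdjoint
  have hν := d.coercive
  obtain ⟨κ, hκ, hβκ⟩ := hβ.exists_absorb d.p_nonneg d.p_le_one 4
  have hz₀ := mem_graph_app h₀.2
  have hθ₀ := graph_add (mem_graph_app h₁) (graph_smul (c 0) hz₀)
  set θ₀ := u₁ + c 0 • app A u₀
  set w₀ := app (sqrtOp A) u₁ + c 0 • app (sqrtOp A) (app A u₀)
  set z₀ := app (sqrtOp A) (app A u₀)
  -- The data enter through |θ₀| and |A^{1/2}θ₀| in Θ and through |A^{3/2}u₀|² in P₀. Contractivity
  -- of J makes these bounds valid for every regularizer J³.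
  obtain ⟨ε₁, C, hε₁, h⟩ := d.regularized_decay (Θ := max ‖θ₀‖ ‖w₀‖) (P₀ := ‖z₀‖ ^ 2) hε₀ hS
    (by positivity) hβ hκ hβκ
  refine ⟨min ε₁ ε₀, lt_min hε₁ hε₀, min_le_right _ _, C, fun ε hε hεlt t ht => ?_⟩
  obtain ⟨l, J, K, hl, hJ, hlim⟩ := exists_resolvent_seq hA hν
  have hρ := mem_graph_app (d.error_mem_domain hε (hεlt.trans_le (min_le_right _ _)) ht)
  have hρS := mem_graph_app (domain_le_domain_sqrt hS (mem_domain_of_mem_graph hρ))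
  have hlim' : Tendsto (fun n => ‖J n (J n (J n (ρ ε t)))‖ ^ 2
      + ⟪J n (J n (J n (app A (ρ ε t)))), J n (J n (J n (ρ ε t)))⟫
      + ε * ‖J n (J n (J n (D (r ε) t)))‖ ^ 2) atTop
      (𝓝 (‖ρ ε t‖ ^ 2 + ⟪app A (ρ ε t), ρ ε t⟫ + ε * ‖D (r ε) t‖ ^ 2)) :=
    (((hlim _).norm.pow 2).add ((hlim _).inner (hlim _))).add (((hlim _).norm.pow 2).const_mul ε)
  rw [sqrt_form_eq hS hρS hρ] at hlim'
  refine le_of_tendsto' hlim' fun n => ?_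
  have hR := (hJ n).isRegularizer hν (hl n) (V := J n)
    (fun x y hxy => (hJ n).map_graph hν (hl n) hxy)
  have hmap : ∀ x y, (x, y) ∈ (sqrtOp A).graph →
      (J n (J n (J n x)), J n (J n (J n y))) ∈ (sqrtOp A).graph := fun x y hxy =>
    (hJ n).map_sqrt hν (hl n) hS ((hJ n).map_sqrt hν (hl n) hS ((hJ n).map_sqrt hν (hl n) hS hxy))
  have hn := (hJ n).norm_pow_three_le
  have hu₀ := mem_graph_app h₀.1
  obtain ⟨-, -, -, -, -, hdecay⟩ := h _ _ _ hR ((hn θ₀).trans (le_max_left _ _)) _ (hmap _ _ hθ₀)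
    ((hn w₀).trans (le_max_right _ _)) (by
      rw [hR.comm' hu₀, hR.comm _ _ hu₀]
      refine (sqrt_form_eq hS (hmap _ _ hz₀) (hR.graph _)).trans_le ?_
      gcongr
      exact hn z₀) ε hε (hεlt.trans_le (min_le_right _ _))
  have := hdecay (hεlt.trans_le (min_le_left _ _)) t ht
  rw [hR.comm _ _ hρ] at this
  exact this

end Data

end

/-! ### The complete estimate and the degenerate square root -/

section

variable {H : Type*} [NormedAddCommGroup H] [InnerProductSpace ℝ H] [CompleteSpace H]

variable {A : H →ₗ.[ℝ] H} {ν p ε₀ μ M₁ M₂ M₃ M₄ M₅ : ℝ} {c : ℝ → ℝ}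
    {cε : ℝ → ℝ → ℝ} {u₀ u₁ : H} {u : ℝ → H} {uε θ ρ r : ℝ → ℝ → H}

/-- The estimates behind the complete bound, for regularized solutions: `J³` applied to the error
quantities, with `J` a resolvent. The constants do not depend on the resolvent. -/
theorem PerturbationData.complete_regularized_bound
    (d : PerturbationData A ν p ε₀ μ M₁ M₂ M₃ M₄ M₅ c cε u₀ u₁ u uε θ ρ r) (hε₀ : 0 < ε₀)
    {S : H →ₗ.[ℝ] H} (hS : IsSqrt A S) (h₀ : MemDomTwo A u₀) (h₁ : u₁ ∈ A.domain)
    {β : ℝ} (hβ : IsDecayRate p (2 * μ * ν) β) :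
    ∃ ε₁ C : ℝ, 0 < ε₁ ∧ ∀ (l : ℝ) (J K : H →L[ℝ] H), 0 < l → IsResolvent A l J K →
      ∀ ε, 0 < ε → ε < ε₀ → ε < ε₁ → ∀ t, 0 ≤ t → ∀ x y z, (ρ ε t, x) ∈ S.graph →
      (ρ ε t, y) ∈ A.graph → (D (r ε) t, z) ∈ S.graph →
      ‖J (J (J x))‖ ^ 2 + ‖J (J (J y))‖ ^ 2 + ε * ‖J (J (J z))‖ ^ 2 ≤
          C * ε ^ 2 * Real.exp (-β * dissipationPrimitive p t) ∧
        ‖J (J (J (D (r ε) t)))‖ ^ 2 ≤ C * ε ^ 2 * Real.exp (-β * dissipationPrimitive p t) := by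
  have hA := d.selfAdjoint
  have hν := d.coercive
  have hν0 := hν.1
  have hμ := d.μ_pos
  have hb := isDissipation_rpow d.p_nonneg d.p_le_one
  -- Two successive losses: β' leaves the factor b² required by `IsDissipation.velocity_decay`, and
  -- κ leaves the factor b⁴ of the source bound.
  obtain ⟨β', hβ', hββ'⟩ := hβ.exists_absorb d.p_nonneg d.p_le_one 2
  obtain ⟨κ, hκ, hβκ⟩ := hβ'.exists_absorb d.p_nonneg d.p_le_one 4
  have hu₀ := mem_graph_app h₀.1
  have hAu₀ := mem_graph_app h₀.2
  obtain ⟨v₀, hv₀, hv₀'⟩ := (hS.2.2 _ _).1 hAu₀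
  set z₀ := app A (app A u₀)
  have hθA := graph_add (mem_graph_app h₁) (graph_smul (c 0) hAu₀)
  set a₀ := app A u₁ + c 0 • z₀
  obtain ⟨s₀, hs₀, hs₀'⟩ := (hS.2.2 _ _).1 hθA
  -- The first system, regularized by J³, serves for its equation and source bound. The second,
  -- regularized by J² A^{1/2} J, serves for its decay.
  obtain ⟨ε₁, C₁, hε₁, hsys₁⟩ := d.regularized_decay
    (Θ := max ‖u₁ + c 0 • app A u₀‖ ‖s₀‖) (P₀ := ‖v₀‖ ^ 2) hε₀ hS (by positivity) hβ' hκ hβκ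
  obtain ⟨ε₂, C₂, hε₂, hsys₂⟩ := d.regularized_decay
    (Θ := max ‖s₀‖ ‖a₀‖) (P₀ := ‖z₀‖ ^ 2) hε₀ hS (by positivity) hβ' hκ hβκ
  obtain ⟨C₃, hC₃, hpar⟩ := (hκ.isAdmissibleRate (m := 2 * μ * ν) d.p_nonneg
    (by positivity)).parabolic_decay hb hμ
  set CF := ((M₂ + M₁ + M₅) / ν + M₁ ^ 2) ^ 2 with hCF
  set Cv := 2 * CF * C₃ * ‖z₀‖ ^ 2 + 2 * M₃ ^ 2 * |C₂| with hCv
  have hCv0 : 0 ≤ Cv := by positivity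
  have hβ0 := hβ.1
  refine ⟨min ε₂ (1 / (2 * (β + 1))), |C₂| + 2 * Cv, by positivity,
    fun l J K hl hJ ε hε hεε₀ hεlt => ?_⟩
  have hεβ : 2 * ε * β ≤ 1 := by
    have h1 := hεlt.trans_le (min_le_right _ _)
    rw [lt_div_iff₀ (by positivity)] at h1
    nlinarith
  obtain ⟨T, hT⟩ := hJ.exists_sqrt_comp hS
  have hR₁ := hJ.isRegularizer hν hl (V := J) (fun x y hxy => hJ.map_graph hν hl hxy)
  have hR₂ := hJ.isRegularizer hν hl (V := T) (fun x y hxy =>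
    hJ.sqrt_comp_map_graph hν hl hS hT hxy)
  have hmap : ∀ x y, (x, y) ∈ S.graph → (J (J (J x)), J (J (J y))) ∈ S.graph := fun x y hxy =>
    hJ.map_sqrt hν hl hS (hJ.map_sqrt hν hl hS (hJ.map_sqrt hν hl hS hxy))
  have hn := hJ.norm_pow_three_le
  have hTS : ∀ x y, (x, y) ∈ S.graph → (J ∘L J ∘L T) x = J (J (J y)) := fun x y hxy => by
    simp only [ContinuousLinearMap.comp_apply]
    rw [graph_unique (hT x).1 (hJ.map_sqrt hν hl hS hxy)]
  have hRK : ∀ x, ((J ∘L J ∘L T) x, (K ∘L J ∘L J) x) ∈ S.graph := fun x => by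
    have h1 := hJ.map_sqrt hν hl hS (hJ.map_sqrt hν hl hS (hT x).2)
    have h2 : K (J (J x)) = J (J (K x)) := by
      rw [hJ.comm hν hl (hJ.graph (J x)), hJ.comm hν hl (hJ.graph x)]
    simp only [ContinuousLinearMap.comp_apply]
    rwa [h2]
  have hKR : ∀ x, ⟪(K ∘L J ∘L T) x, (J ∘L J ∘L T) x⟫ = ‖(K ∘L J ∘L J) x‖ ^ 2 := fun x =>
    sqrt_form_eq hS (hRK x) (hR₂.graph x)
  have hLK : ∀ x y, (x, y) ∈ A.graph → ⟪(K ∘L K ∘L T) x, (K ∘L J ∘L T) x⟫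
      = ‖(K ∘L K ∘L J) x‖ ^ 2 := fun x y hxy => by
    rw [hR₂.comm' hxy, hR₂.comm _ _ hxy, hR₁.comm' hxy]
    exact hKR y
  have hK₀ : ‖(K ∘L J ∘L J) (app A u₀)‖ ≤ ‖z₀‖ := by
    rw [hR₁.comm _ _ hAu₀]; exact hn z₀
  obtain ⟨c₁, P₁', s₁', F₁, sys₁, -⟩ := hsys₁ _ _ _ hR₁ ((hn _).trans (le_max_left _ _)) _
    (hmap _ _ hs₀) ((hn s₀).trans (le_max_right _ _)) (by
      rw [hR₁.comm' hu₀, hR₁.comm _ _ hu₀]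
      refine (sqrt_form_eq hS (hmap _ _ hv₀) (hR₁.graph _)).trans_le ?_
      gcongr
      exact hn v₀) ε hε hεε₀
  obtain ⟨c₂, P₂', s₂', F₂, sys₂, hdec₂⟩ := hsys₂ _ _ _ hR₂
    (by rw [hTS _ _ hs₀]; exact (hn s₀).trans (le_max_left _ _)) (J (J (J a₀)))
    (by rw [hTS _ _ hs₀]; exact hmap _ _ hs₀') ((hn a₀).trans (le_max_right _ _)) (by
      rw [hR₂.comm' hu₀, hR₂.comm _ _ hu₀, hKR]
      gcongr) ε hε hεε₀
  have hdec : ∀ t, 0 ≤ t → ‖(J ∘L J ∘L T) (ρ ε t)‖ ^ 2 + ‖(K ∘L J ∘L J) (ρ ε t)‖ ^ 2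
      + ε * ‖(J ∘L J ∘L T) (D (r ε) t)‖ ^ 2 ≤
      |C₂| * ε ^ 2 * Real.exp (-β' * dissipationPrimitive p t) := fun t ht => by
    have h1 := hdec₂ (hεlt.trans_le (min_le_left _ _)) t ht
    rw [hKR] at h1
    refine h1.trans ?_
    gcongr
    exact le_abs_self _
  -- The parabolic dissipation of the first system is the parabolic energy of the second, one half
  -- power of A higher; hence it decays pointwise and not only in the integrated sense.
  have hZ : ∀ t, 0 ≤ t → ‖(K ∘L K ∘L J) (u t)‖ ^ 2 ≤
      C₃ * ‖z₀‖ ^ 2 * Real.exp (-κ * dissipationPrimitive p t) := fun t ht => by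
    have h1 := hpar _ _ _ sys₂.parabolic_deriv sys₂.parabolic_nonneg sys₂.parabolic_coercive
      sys₂.dissipation_nonneg sys₂.parabolic_deriv_le t ht
    rw [hLK _ _ (d.parabolic.graph ht)] at h1
    refine h1.trans ?_
    gcongr
    exact sys₂.parabolic_initial
  have hexp : ∀ t, 0 ≤ t → Real.exp (-β' * dissipationPrimitive p t) ≤
      ((1 + t) ^ (-p)) ^ 2 * Real.exp (-β * dissipationPrimitive p t) := fun t ht => by
    calc Real.exp (-β' * dissipationPrimitive p t) = Real.exp (β * dissipationPrimitive p t) *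
          Real.exp (-β' * dissipationPrimitive p t - β * dissipationPrimitive p t) := by
          rw [← Real.exp_add]; congr 1; ring
      _ ≤ ((1 + t) ^ (-p)) ^ 2 * Real.exp (β' * dissipationPrimitive p t) *
          Real.exp (-β' * dissipationPrimitive p t - β * dissipationPrimitive p t) := by
          gcongr; exact hββ' t ht
      _ = _ := by rw [mul_assoc, ← Real.exp_add]; congr 2; ring
  -- The right side of the first-order equation for s: the source decays by `hZ`, and Aρ by the
  -- second system.
  have hG : ∀ t, 0 ≤ t → ‖F₁ t - cε ε t • (K ∘L J ∘L J) (ρ ε t)‖ ^ 2 ≤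
      Cv * ε ^ 2 * (((1 + t) ^ (-p)) ^ 2 * Real.exp (-β * dissipationPrimitive p t)) := by
    intro t ht
    have hbt := hb.pos t ht
    have hF : ‖F₁ t‖ ^ 2 ≤ ε ^ 2 * CF * (C₃ * ‖z₀‖ ^ 2
        * Real.exp (-β' * dissipationPrimitive p t)) := by
      have h1 := sys₁.source_le t ht
      have h2 : Real.exp (-κ * dissipationPrimitive p t) ≤
          ((1 + t) ^ (-p)) ^ 4 * Real.exp (-β' * dissipationPrimitive p t) := by
        calc Real.exp (-κ * dissipationPrimitive p t) = Real.exp (β' * dissipationPrimitive p t) *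
              Real.exp (-κ * dissipationPrimitive p t - β' * dissipationPrimitive p t) := by
              rw [← Real.exp_add]; congr 1; ring
          _ ≤ ((1 + t) ^ (-p)) ^ 4 * Real.exp (κ * dissipationPrimitive p t) *
              Real.exp (-κ * dissipationPrimitive p t - β' * dissipationPrimitive p t) := by
              gcongr; exact hβκ t ht
          _ = _ := by rw [mul_assoc, ← Real.exp_add]; congr 2; ring
      refine le_of_mul_le_mul_left ?_ (pow_pos hbt 4)
      calc _ ≤ ε ^ 2 * CF * ‖(K ∘L K ∘L J) (u t)‖ ^ 2 := h1
        _ ≤ ε ^ 2 * CF * (C₃ * ‖z₀‖ ^ 2 * (((1 + t) ^ (-p)) ^ 4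
            * Real.exp (-β' * dissipationPrimitive p t))) := by
          have h3 := (hZ t ht).trans (mul_le_mul_of_nonneg_left h2 (by positivity))
          exact mul_le_mul_of_nonneg_left h3 (by positivity)
        _ = _ := by ring
    have hKρ : ‖cε ε t • (K ∘L J ∘L J) (ρ ε t)‖ ^ 2 ≤
        M₃ ^ 2 * (|C₂| * ε ^ 2 * Real.exp (-β' * dissipationPrimitive p t)) := by
      have h1 := hdec t ht
      have h2 : 0 ≤ ‖(J ∘L J ∘L T) (ρ ε t)‖ ^ 2 := sq_nonneg _
      have h3 : 0 ≤ ε * ‖(J ∘L J ∘L T) (D (r ε) t)‖ ^ 2 := by positivity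
      have h4 : 0 ≤ cε ε t := hμ.le.trans (d.lower' ε hε hεε₀ t ht)
      rw [norm_smul, mul_pow, Real.norm_of_nonneg h4]
      gcongr
      · exact d.upper' ε hε hεε₀ t ht
      · linarith
    have h5 : ‖F₁ t - cε ε t • (K ∘L J ∘L J) (ρ ε t)‖ ^ 2 ≤
        2 * ‖F₁ t‖ ^ 2 + 2 * ‖cε ε t • (K ∘L J ∘L J) (ρ ε t)‖ ^ 2 := by
      have h6 := pow_le_pow_left₀ (norm_nonneg _)
        (norm_sub_le (F₁ t) (cε ε t • (K ∘L J ∘L J) (ρ ε t))) 2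
      nlinarith [sq_nonneg (‖F₁ t‖ - ‖cε ε t • (K ∘L J ∘L J) (ρ ε t)‖)]
    calc _ ≤ Cv * ε ^ 2 * Real.exp (-β' * dissipationPrimitive p t) := by
          rw [hCv]; linarith
      _ ≤ _ := by gcongr; exact hexp t ht
  intro t ht x y z hx hy hz
  have hE := (Real.exp_pos (-β * dissipationPrimitive p t)).le
  have hvel := hb.velocity_decay hCv0 hε hεβ sys₁.velocity_deriv
    (G := fun t => F₁ t - cε ε t • (K ∘L J ∘L J) (ρ ε t))
    (fun t ht => by rw [sys₁.equation t ht]; abel) sys₁.velocity_zero hG ht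
  constructor
  · have h1 := hdec t ht
    rw [hTS _ _ hx, hTS _ _ hz, hR₁.comm _ _ hy] at h1
    refine h1.trans ?_
    have h2 : Real.exp (-β' * dissipationPrimitive p t) ≤
        1 * Real.exp (-β * dissipationPrimitive p t) := by
      refine (hexp t ht).trans ?_
      gcongr
      exact pow_le_one₀ (hb.pos t ht).le (hb.le_one t ht)
    rw [one_mul] at h2
    calc _ ≤ |C₂| * ε ^ 2 * Real.exp (-β * dissipationPrimitive p t) := by gcongr
      _ ≤ _ := by gcongr; linarith
  · refine hvel.trans ?_
    gcongr
    linarith [abs_nonneg C₂]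

/-- The complete estimate, for data in `D(A²) × D(A)`. -/
theorem PerturbationData.complete_bound
    (d : PerturbationData A ν p ε₀ μ M₁ M₂ M₃ M₄ M₅ c cε u₀ u₁ u uε θ ρ r) (hε₀ : 0 < ε₀)
    (hS : IsSqrt A (sqrtOp A)) (h₀ : MemDomTwo A u₀) (h₁ : u₁ ∈ A.domain)
    {β : ℝ} (hβ : IsDecayRate p (2 * μ * ν) β) :
    ErrorBound ε₀ (fun ε => gammaComplete A ε (ρ ε) (r ε))
      (fun t => Real.exp (-β * dissipationPrimitive p t)) := by
  have hν := d.coercive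
  have hν0 := hν.1
  obtain ⟨ε₁, C, hε₁, h⟩ := d.complete_regularized_bound hε₀ hS h₀ h₁ hβ
  refine ⟨min ε₁ ε₀, lt_min hε₁ hε₀, min_le_right _ _, C + C + 1 / ν ^ 2 * C,
    fun ε hε hεlt t ht => ?_⟩
  have hεε₁ := hεlt.trans_le (min_le_left _ _)
  have hεε₀ := hεlt.trans_le (min_le_right _ _)
  obtain ⟨l, J, K, hl, hJ, hlim⟩ := exists_resolvent_seq d.selfAdjoint hν
  have hρ := mem_graph_app (d.error_mem_domain hε hεε₀ ht)
  have hρS := mem_graph_app (domain_le_domain_sqrt hS (mem_domain_of_mem_graph hρ))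
  have hr := mem_graph_app (d.D_remainder_mem hS ⟨h₀.1, domain_le_domain_sqrt hS h₀.2⟩
    (domain_le_domain_sqrt hS h₁) hε hεε₀ ht)
  have b1 := le_of_tendsto' ((((hlim (app (sqrtOp A) (ρ ε t))).norm.pow 2).add
    ((hlim (app A (ρ ε t))).norm.pow 2)).add
      (((hlim (app (sqrtOp A) (D (r ε) t))).norm.pow 2).const_mul ε)) fun n =>
        (h _ _ _ (hl n) (hJ n) ε hε hεε₀ hεε₁ t ht _ _ _ hρS hρ hr).1
  have b2 := le_of_tendsto' ((hlim (D (r ε) t)).norm.pow 2) fun n =>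
    (h _ _ _ (hl n) (hJ n) ε hε hεε₀ hεε₁ t ht _ _ _ hρS hρ hr).2
  -- The regularized bounds do not contain |ρ|² itself; it is recovered from |Aρ|² through ν|ρ| ≤
  -- |Aρ|.
  have b3 : ‖ρ ε t‖ ^ 2 ≤ 1 / ν ^ 2 * ‖app A (ρ ε t)‖ ^ 2 := by
    have h1 := pow_le_pow_left₀ (by positivity) (hν.mul_norm_le hρ) 2
    rw [one_div, inv_mul_eq_div, le_div_iff₀ (by positivity)]
    linarith
  have b4 : 1 / ν ^ 2 * ‖app A (ρ ε t)‖ ^ 2 ≤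
      1 / ν ^ 2 * (C * ε ^ 2 * Real.exp (-β * dissipationPrimitive p t)) := by
    gcongr
    have : 0 ≤ ε * ‖app (sqrtOp A) (D (r ε) t)‖ ^ 2 := by positivity
    have : 0 ≤ ‖app (sqrtOp A) (ρ ε t)‖ ^ 2 := by positivity
    linarith
  simp only [gammaComplete]
  linarith

theorem app_zero (T : H →ₗ.[ℝ] H) : app T 0 = 0 :=
  app_eq_of_mem_graph T.graph.zero_mem

/-- The degenerate convention `sqrtOp A = ⊥`, which no self-adjoint coercive `A` actually meets,
forces all solutions to vanish. This spares a construction of the square root. -/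
theorem PerturbationData.eq_zero_of_not_exists_sqrt
    (d : PerturbationData A ν p ε₀ μ M₁ M₂ M₃ M₄ M₅ c cε u₀ u₁ u uε θ ρ r)
    (hS : ¬ ∃ S, IsSqrt A S) {ε : ℝ} (hε : 0 < ε) (hεε₀ : ε < ε₀) {t : ℝ} (ht : 0 ≤ t) :
    ρ ε t = 0 ∧ D (r ε) t = 0 := by
  have hb := isDissipation_rpow d.p_nonneg d.p_le_one
  have hbot : sqrtOp A = ⊥ := dif_neg hS
  have hv := d.hyperbolic ε hε hεε₀
  have hv0 : ∀ t, 0 ≤ t → uε ε t = 0 := fun t ht => by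
    have := hv.inDomainHalf.1 t ht
    rw [hbot] at this
    exact (Submodule.mem_bot ℝ).1 this
  have hDzero : ∀ w : ℝ → H, (∀ t, 0 ≤ t → w t = 0) → ∀ t, 0 ≤ t → D w t = 0 := fun w hw t ht =>
    D_eq ht ((hasDerivWithinAt_const t (Ici 0) (0 : H)).congr (fun x hx => hw x hx) (hw t ht))
  have hu₀ : u₀ = 0 := by rw [← hv.initial, hv0 0 le_rfl]
  have hu₁ : u₁ = 0 := by rw [← hv.initial_deriv, hDzero _ hv0 0 le_rfl]
  have hu0 : ∀ t, 0 ≤ t → u t = 0 := fun t ht => by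
    have h := le_initial_of_hasDerivWithinAt_nonpos
      (fun t ht => (hasDerivWithinAt_D d.parabolic.contDiff ht).norm_sq) (fun t ht => by
        rw [d.parabolic.D_eq_smul hb (fun t ht => rpow_neg_eq ht) ht, real_inner_smul_right,
          real_inner_comm]
        have h1 := d.coercive.le_inner (d.parabolic.graph ht)
        have h2 := d.μ_pos.trans_le (d.lower t ht)
        have h3 := hb.pos t ht
        have h4 : 0 ≤ ⟪app A (u t), u t⟫ :=
          le_trans (mul_nonneg d.coercive.1.le (sq_nonneg _)) h1
        have : 0 ≤ c t / (1 + t) ^ (-p) * ⟪app A (u t), u t⟫ := by positivity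
        linarith) ht
    rw [d.parabolic.initial, hu₀, norm_zero, zero_pow two_ne_zero] at h
    exact norm_eq_zero.1 (pow_eq_zero_iff two_ne_zero |>.1 (le_antisymm h (sq_nonneg _)))
  refine ⟨by rw [d.error_eq, hv0 t ht, hu0 t ht, sub_zero], ?_⟩
  rw [d.D_remainder hε hεε₀ ht, hDzero _ hv0 t ht, hDzero _ hu0 t ht,
    (d.corrector ε hε hεε₀).D_eq_exp_smul hε hb (fun t ht => rpow_neg_eq ht) ht, hu₀, hu₁, app_zero]
  simp

end

end WeakDissipation

/-! ### The singular perturbation theorem -/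

theorem theorem2p10
    {H : Type*} [NormedAddCommGroup H] [InnerProductSpace ℝ H] [CompleteSpace H]
    (A : H →ₗ.[ℝ] H) (hA : IsSelfAdjoint A)
    (ν : ℝ) (hν : WeakDissipation.IsCoercive A ν)
    (p : ℝ) (hp0 : 0 ≤ p) (hp1 : p ≤ 1)
    (u₀ u₁ : H) (hu₀ : u₀ ∈ A.domain) (hu₁ : WeakDissipation.MemDomHalf A u₁)
    (ε₀ : ℝ) (hε₀ : 0 < ε₀)
    (μ M₁ M₂ M₃ M₄ M₅ : ℝ) (hμ : 0 < μ)
    (c : ℝ → ℝ) (hc : ContDiffOn ℝ 1 c (Set.Ici 0))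
    (hc_lower : ∀ t, 0 ≤ t → μ ≤ c t)
    (hc_upper : ∀ t, 0 ≤ t → c t ≤ M₁)
    (hc_deriv : ∀ t, 0 ≤ t → |WeakDissipation.D c t| ≤ M₂)
    (cε : ℝ → ℝ → ℝ)
    (hcε : ∀ ε, 0 < ε → ε < ε₀ → ContDiffOn ℝ 1 (cε ε) (Set.Ici 0))
    (hcε_lower : ∀ ε, 0 < ε → ε < ε₀ → ∀ t, 0 ≤ t → μ ≤ cε ε t)
    (hcε_upper : ∀ ε, 0 < ε → ε < ε₀ → ∀ t, 0 ≤ t → cε ε t ≤ M₃)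
    (hcε_deriv : ∀ ε, 0 < ε → ε < ε₀ → ∀ t, 0 ≤ t →
      |WeakDissipation.D (cε ε) t| ≤ M₄ / (1 + t) ^ p)
    (hcε_c : ∀ ε, 0 < ε → ε < ε₀ → ∀ t, 0 ≤ t → |cε ε t - c t| ≤ M₅ * ε)
    (u : ℝ → H) (hu : WeakDissipation.IsParabolicSolution A p c u₀ u)
    (uε : ℝ → ℝ → H)
    (huε : ∀ ε, 0 < ε → ε < ε₀ →
      WeakDissipation.IsHyperbolicSolution A p ε (cε ε) u₀ u₁ (uε ε))
    (θ : ℝ → ℝ → H)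
    (hθ : ∀ ε, 0 < ε → ε < ε₀ →
      WeakDissipation.IsCorrector p ε (u₁ + c 0 • WeakDissipation.app A u₀) (θ ε))
    (ρ r : ℝ → ℝ → H)
    (hρ : ∀ ε t, ρ ε t = uε ε t - u t)
    (hr : ∀ ε t, r ε t = uε ε t - u t - θ ε t) :
    (WeakDissipation.MemDomThreeHalves A u₀ → WeakDissipation.MemDomHalf A u₁ →
      (∀ ε, 0 < ε → ε < ε₀ → ∀ t, 0 ≤ t → WeakDissipation.MemDomHalf A (ρ ε t)) ∧
      WeakDissipation.DecayErrorEstimates p μ ν ε₀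
        (fun ε => WeakDissipation.gammaReduced A ε (ρ ε) (r ε))) ∧
    (WeakDissipation.MemDomTwo A u₀ → u₁ ∈ A.domain →
      (∀ ε, 0 < ε → ε < ε₀ → ∀ t, 0 ≤ t →
        WeakDissipation.MemDomHalf A (ρ ε t) ∧ ρ ε t ∈ A.domain ∧
        WeakDissipation.MemDomHalf A (WeakDissipation.D (r ε) t)) ∧
      WeakDissipation.DecayErrorEstimates p μ ν ε₀
        (fun ε => WeakDissipation.gammaComplete A ε (ρ ε) (r ε))) := by
  have d : WeakDissipation.PerturbationData A ν p ε₀ μ M₁ M₂ M₃ M₄ M₅ c cε u₀ u₁ u uε θ ρ r :=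
    ⟨hA, hν, hp0, hp1, hμ, hc, hc_lower, hc_upper, hc_deriv, hcε, hcε_lower, hcε_upper, hcε_deriv,
      hcε_c, hu, huε, hθ, hρ, hr⟩
  by_cases hS : ∃ S, WeakDissipation.IsSqrt A S
  · have hsqrt : WeakDissipation.IsSqrt A (WeakDissipation.sqrtOp A) := by
      rw [WeakDissipation.sqrtOp, dif_pos hS]
      exact hS.choose_spec
    have hhalf : ∀ x, x ∈ A.domain → WeakDissipation.MemDomHalf A x := fun x hx =>
      WeakDissipation.domain_le_domain_sqrt hsqrt hx
    refine ⟨fun h₀ h₁ => ⟨fun ε hε hεε₀ t ht => hhalf _ (d.error_mem_domain hε hεε₀ ht), ?_⟩,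
      fun h₀ h₁ => ⟨fun ε hε hεε₀ t ht => ⟨hhalf _ (d.error_mem_domain hε hεε₀ ht),
        d.error_mem_domain hε hεε₀ ht,
        d.D_remainder_mem hsqrt ⟨h₀.1, hhalf _ h₀.2⟩ (hhalf _ h₁) hε hεε₀ ht⟩, ?_⟩⟩
    · exact WeakDissipation.decayErrorEstimates_of_forall hμ hν.1 fun β hβ =>
        d.reduced_bound hε₀ hsqrt h₀ h₁ hβ
    · exact WeakDissipation.decayErrorEstimates_of_forall hμ hν.1 fun β hβ =>
        d.complete_bound hε₀ hsqrt h₀ h₁ hβ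
  · have hzero := fun ε (hε : 0 < ε) (hεε₀ : ε < ε₀) t (ht : 0 ≤ t) =>
      d.eq_zero_of_not_exists_sqrt hS hε hεε₀ ht
    refine ⟨fun _ _ => ⟨fun ε hε hεε₀ t ht => ?_, ?_⟩,
      fun _ _ => ⟨fun ε hε hεε₀ t ht => ⟨?_, ?_, ?_⟩, ?_⟩⟩
    · rw [(hzero ε hε hεε₀ t ht).1]; exact Submodule.zero_mem _
    · refine WeakDissipation.decayErrorEstimates_of_forall hμ hν.1 fun β _ =>
        ⟨ε₀, hε₀, le_rfl, 0, fun ε hε hεε₀ t ht => ?_⟩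
      simp [WeakDissipation.gammaReduced, hzero ε hε hεε₀ t ht, WeakDissipation.app_zero]
    · rw [(hzero ε hε hεε₀ t ht).1]; exact Submodule.zero_mem _
    · rw [(hzero ε hε hεε₀ t ht).1]; exact Submodule.zero_mem _
    · rw [(hzero ε hε hεε₀ t ht).2]; exact Submodule.zero_mem _
    · refine WeakDissipation.decayErrorEstimates_of_forall hμ hν.1 fun β _ =>
        ⟨ε₀, hε₀, le_rfl, 0, fun ε hε hεε₀ t ht => ?_⟩
      simp [WeakDissipation.gammaComplete, hzero ε hε hεε₀ t ht, WeakDissipation.app_zero]
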